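/- Let $\mathbb{R}^3_1$ be $\mathbb{R}^3$ with the Lorentzian metric $\langle a,b\rangle=-a_1b_1+a_2b_2+a_3b_3$, let $\mathbb{H}^2=\{x\in\mathbb{R}^3_1:\langle x,x\rangle=-1,\ x_1>0\}$ with complex structure $J_xu=x\boxtimes u$, where $a\boxtimes b=(a_3b_2-a_2b_3,\,a_3b_1-a_1b_3,\,a_1b_2-a_2b_1)$, and give $\mathbb{H}^2\times\mathbb{H}^2\subset\mathbb{R}^3_1\times\mathbb{R}^3_1$ the product metric. On $\mathbb{H}^2\times\mathbb{H}^2$ put $J_1=(J,J)$, $J_2=(J,-J)$ and $P(v_1,v_2)=(v_1,-v_2)$. Let $M$ be a smooth $3$-manifold, $f:M\to\mathbb{H}^2\times\mathbb{H}^2$ a smooth immersion with smooth unit normal vector field $N$, and let $A$ be its shape operator, $\bar\nabla_XN=-AX$. Assume that the product angle function $\langle PN,N\rangle$ is equal to a constant $C$ with $|C|<1$, and put $c=\frac{1-C}{2}$. Then the following are equivalent. (1) $J_1N+J_2N$ is a principal curvature vector field of $M$, i.e. at each point it is a nonzero tangent vector of $M$ which is an eigenvector of $A$. (2) $M$ is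 an open part of a hypersurface $M^c_{\kappa,\tilde\kappa}$ built from two curves: there are smooth curves $\gamma:I\to\mathbb{H}^2$ and $\tilde\gamma:\tilde I\to\mathbb{H}^2$, parametrized by arc length on open intervals $I,\tilde I\subset\mathbb{R}$, with smooth unit normal vector fields $n,\tilde n$ in $\mathbb{H}^2$ and curvatures $\kappa=\langle\gamma'',n\rangle$, $\tilde\kappa=\langle\tilde\gamma'',\tilde n\rangle$, and there is an open set $\Omega\subset\mathbb{R}\times I\times\tilde I$ such that $$\Phi(t,r,s)=\big(\cosh(\sqrt c\,t)\gamma(r)+\sinh(\sqrt c\,t)n(r),\ \cosh(\sqrt{1-c}\,t)\tilde\gamma(s)+\sinh(\sqrt{1-c}\,t)\tilde n(s)\big)$$ is an immersion on $\Omega$ and $M$ is the hypersurface $\Phi(\Omega)$, i.e. there is a smooth surjective map $g:\Omega\to M$ with $f\circ g=\Phi|_\Omega$ (neither $M$ nor $\Omega$ is required to be connected). -/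

import Mathlib

open scoped Manifold ContDiff

noncomputable section

namespace HypProd

/-- The vector space underlying the Minkowski space `ℝ₁³`. Coordinates are indexed by `0, 1, 2`,
the coordinate `0` being the timelike one. The norm of this type is only used for its topology
and for smoothness. -/
abbrev R3 : Type := Fin 3 → ℝ

/-- The vector space underlying `ℝ₁³ × ℝ₁³`. -/
abbrev R6 : Type := R3 × R3

/-- The Lorentzian metric of `ℝ₁³`. -/
def mink (a b : R3) : ℝ := -(a 0 * b 0) + a 1 * b 1 + a 2 * b 2

/-- The product metric of `ℝ₁³ × ℝ₁³`. -/
def mink2 (v w : R6) : ℝ := mink v.1 w.1 + mink v.2 w.2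

/-- The hyperbolic plane of curvature `-1`, as a subset of `ℝ₁³`. -/
def H2 : Set R3 := {x | mink x x = -1 ∧ 0 < x 0}

/-- The Lorentzian cross product. -/
def lcross (a b : R3) : R3 :=
  ![a 2 * b 1 - a 1 * b 2, a 2 * b 0 - a 0 * b 2, a 0 * b 1 - a 1 * b 0]

/-- The complex structure `J₁ = (J, J)` at the point `z`, where `J_x u` is the Lorentzian cross
product of `x` and `u`. -/
def J1 (z w : R6) : R6 := (lcross z.1 w.1, lcross z.2 w.2)

/-- The complex structure `J₂ = (J, -J)` at the point `z`. -/
def J2 (z w : R6) : R6 := (lcross z.1 w.1, -lcross z.2 w.2)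

/-- The product structure `P (v₁, v₂) = (v₁, -v₂)`. -/
def P (w : R6) : R6 := (w.1, -w.2)

/-- The projection of `ℝ₁³ × ℝ₁³` onto the tangent space of `ℍ² × ℍ²` at `z`, orthogonal for
the product metric (recall that `⟨z.1, z.1⟩ = ⟨z.2, z.2⟩ = -1` there). -/
def tangentProj (z w : R6) : R6 :=
  (w.1 + mink w.1 z.1 • z.1, w.2 + mink w.2 z.2 • z.2)

section Hypersurface

variable {M : Type*} [TopologicalSpace M] [ChartedSpace (EuclideanSpace ℝ (Fin 3)) M]

/-- The differential at `x` of a map from a 3-manifold to `ℝ₁³ × ℝ₁³`. -/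
def diff (F : M → R6) (x : M) : TangentSpace (𝓡 3) x →L[ℝ] R6 :=
  mfderiv (𝓡 3) 𝓘(ℝ, R6) F x

/-- `f : M → ℍ² × ℍ²` is a smooth immersed hypersurface, and `N` is a smooth unit normal vector
field along it (tangent to `ℍ² × ℍ²`, of length one, orthogonal to the image of `df`). -/
structure IsOrientedHypersurface (f N : M → R6) : Prop where
  smooth : ContMDiff (𝓡 3) 𝓘(ℝ, R6) ∞ f
  mem : ∀ x, (f x).1 ∈ H2 ∧ (f x).2 ∈ H2
  immersion : ∀ x, Function.Injective (diff f x)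
  smooth_normal : ContMDiff (𝓡 3) 𝓘(ℝ, R6) ∞ N
  normal_tangent : ∀ x, mink (N x).1 (f x).1 = 0 ∧ mink (N x).2 (f x).2 = 0
  normal_unit : ∀ x, mink2 (N x) (N x) = 1
  normal_orthogonal : ∀ x, ∀ X : TangentSpace (𝓡 3) x, mink2 (diff f x X) (N x) = 0

/-- The product angle function `C = ⟨P N, N⟩`. -/
def productAngle (N : M → R6) (x : M) : ℝ := mink2 (P (N x)) (N x)

/-- `∇̄_X N`, the derivative of `N` along `f` in the direction `X` for the Levi-Civita connection
of `ℍ² × ℍ²`: the tangential part of the derivative in the ambient flat space. -/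
def covDerivNormal (f N : M → R6) (x : M) (X : TangentSpace (𝓡 3) x) : R6 :=
  tangentProj (f x) (diff N x X)

/-- The field `W` along `f` is a principal curvature vector field: at each point it is a nonzero
tangent vector `df (X)` with `A X = l X` for some real `l`, where the shape operator `A` is given
by the Weingarten formula `∇̄_X N = - df (A X)`. -/
def IsPrincipalField (f N W : M → R6) : Prop :=
  ∀ x, ∃ X : TangentSpace (𝓡 3) x, X ≠ 0 ∧ diff f x X = W x ∧
    ∃ l : ℝ, covDerivNormal f N x X = -diff f x (l • X)

end Hypersurface

/-- `γ` is a smooth curve of `ℍ²` on the open interval `I`, parametrized by arc length, `n` is a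
smooth unit normal vector field of `γ` in `ℍ²`, and `κ` is the curvature of `γ` with respect to
`n`, that is `⟨γ'', n⟩`. -/
structure IsCurveWithNormal (I : Set ℝ) (γ n : ℝ → R3) (κ : ℝ → ℝ) : Prop where
  isOpen : IsOpen I
  isConnected : IsConnected I
  smooth : ContDiffOn ℝ ∞ γ I
  smooth_normal : ContDiffOn ℝ ∞ n I
  mem : ∀ r ∈ I, γ r ∈ H2
  unit_speed : ∀ r ∈ I, mink (deriv γ r) (deriv γ r) = 1
  normal_tangent : ∀ r ∈ I, mink (n r) (γ r) = 0
  normal_unit : ∀ r ∈ I, mink (n r) (n r) = 1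
  normal_orthogonal : ∀ r ∈ I, mink (n r) (deriv γ r) = 0
  curvature : ∀ r ∈ I, κ r = mink (deriv (deriv γ) r) (n r)

/-- The map `(t, r, s) ↦ (p(t, r), q(t, s))` that defines the hypersurface built from the curves
`γ`, `γ'` with unit normal fields `n`, `n'`. -/
def curveMap (c : ℝ) (γ n γ' n' : ℝ → R3) (w : ℝ × ℝ × ℝ) : R6 :=
  (Real.cosh (√c * w.1) • γ w.2.1 + Real.sinh (√c * w.1) • n w.2.1,
    Real.cosh (√(1 - c) * w.1) • γ' w.2.2 + Real.sinh (√(1 - c) * w.1) • n' w.2.2)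

/-- The immersed hypersurface `f : M → ℍ² × ℍ²` is the image of an open set `Ω` of parameters in
`ℝ × I × I'` on which `Φ` is an immersion: there is a smooth map `g` from `Ω` onto `M` with
`f ∘ g = Φ` on `Ω` (such a `g` is automatically a local diffeomorphism; when `f` is the inclusion
of an embedded hypersurface this says that `M = Φ(Ω)`). -/
def IsOpenPart {M : Type*} [TopologicalSpace M] [ChartedSpace (EuclideanSpace ℝ (Fin 3)) M]
    (f : M → R6) (I I' : Set ℝ) (Φ : ℝ × ℝ × ℝ → R6) : Prop :=
  ∃ (Ω : Set (ℝ × ℝ × ℝ)) (g : ℝ × ℝ × ℝ → M),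
    IsOpen Ω ∧ (∀ w ∈ Ω, w.2.1 ∈ I ∧ w.2.2 ∈ I') ∧
    (∀ w ∈ Ω, Function.Injective (fderiv ℝ Φ w)) ∧
    ContMDiffOn 𝓘(ℝ, ℝ × ℝ × ℝ) (𝓡 3) ∞ g Ω ∧
    g '' Ω = Set.univ ∧
    ∀ w ∈ Ω, f (g w) = Φ w

end HypProd

end

/-!
The idea is to integrate the frame of the hypersurface by closed `1`-forms. Write `c = (1 - C) / 2`,
`f = (p, q)` and `N = (√(1 - c) u, -√c v)`: constancy of the product angle says precisely that `u`
and `v` are unit tangent fields along the maps `p` and `q` to `ℍ²`, and `J₁ N + J₂ N` is a multiple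
of `(J u, 0)`. If this is a principal direction, the symmetry of the shape operator shows that
`(0, J v)` is principal as well and that `du = ⟨u, dp⟩ p + k ⟨J u, dp⟩ J u`, and similarly for `v`
(`weingarten_of_principal`). Hence `⟨u, dp⟩` is closed; its primitive is `√c t`, and that of
`⟨v, dq⟩` is then `√(1 - c) t`. Going back for this time along the geodesics tangent to `u`, one
obtains the frame `(cosh p - sinh u, -sinh p + cosh u)`, which turns out to move in the single
direction `J u`. Its arc length is a second function `r`, and `q` gives in the same way a third
function `s` (`IsGeodesicField.exists_arcLength_of_footpoint`). By the inverse function theorem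
`(t, r, s)` are local coordinates, in which `f` is the map of two curves
(`exists_adapted_coordinates`). Neither flows nor the Frobenius theorem are needed.

This is local, while the statement asks for a single pair of curves. Countably many of the local
pieces cover `M`, and since all their curves satisfy `γ' = J n` they can be strung along one
arc-length curve of `ℍ²` (`exists_isFrenetCurve_through`). The plane coordinates `x₁, x₂` reduce
this to the interpolation of regular plane curves, where the zeros of the velocity are removed by a
general position argument (`exists_regular_interpolation`).

Conversely, on the hypersurface of two curves the normal is `(√(1 - c) u, -√c v)` up to sign, where
`u` and `v` are the velocities of the normal geodesics, and along the parallels of the first curve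
both `f` and `N` move in the direction `(J u, 0)` (`principal_of_curves`).
-/

namespace HypProd

/-! ### Lorentz algebra -/

/-- The Lorentzian metric as a continuous bilinear form. -/
noncomputable def minkL : R3 →L[ℝ] R3 →L[ℝ] ℝ :=
  (LinearMap.mk₂ ℝ mink (by intros; simp [mink]; ring) (by intros; simp [mink]; ring)
    (by intros; simp [mink]; ring) (by intros; simp [mink]; ring)).toContinuousBilinearMap

@[simp] lemma minkL_apply (a b : R3) : minkL a b = mink a b := rfl

/-- The Lorentzian cross product as a continuous bilinear map. -/
noncomputable def lcrossL : R3 →L[ℝ] R3 →L[ℝ] R3 :=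
  (LinearMap.mk₂ ℝ lcross
    (by intros; ext i; fin_cases i <;> simp [lcross] <;> ring)
    (by intros; ext i; fin_cases i <;> simp [lcross] <;> ring)
    (by intros; ext i; fin_cases i <;> simp [lcross] <;> ring)
    (by intros; ext i; fin_cases i <;> simp [lcross] <;> ring)).toContinuousBilinearMap

lemma mink_comm (a b : R3) : mink a b = mink b a := by simp only [mink]; ring

@[simp] lemma mink_add_left (a b d : R3) : mink (a + b) d = mink a d + mink b d := by
  simp only [mink, Pi.add_apply]; ring

@[simp] lemma mink_add_right (a b d : R3) : mink d (a + b) = mink d a + mink d b := by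
  simp only [mink, Pi.add_apply]; ring

@[simp] lemma mink_smul_left (s : ℝ) (a b : R3) : mink (s • a) b = s * mink a b := by
  simp only [mink, Pi.smul_apply, smul_eq_mul]; ring

@[simp] lemma mink_smul_right (s : ℝ) (a b : R3) : mink a (s • b) = s * mink a b := by
  simp only [mink, Pi.smul_apply, smul_eq_mul]; ring

@[simp] lemma mink_neg_left (a b : R3) : mink (-a) b = -mink a b := by
  simp only [mink, Pi.neg_apply]; ring

@[simp] lemma mink_neg_right (a b : R3) : mink a (-b) = -mink a b := by
  simp only [mink, Pi.neg_apply]; ring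

@[simp] lemma mink_zero_left (a : R3) : mink 0 a = 0 := by simp [mink]

@[simp] lemma mink_zero_right (a : R3) : mink a 0 = 0 := by simp [mink]

@[simp] lemma mink_lcross_left (a b : R3) : mink (lcross a b) a = 0 := by
  simp [mink, lcross]; ring

@[simp] lemma mink_lcross_right (a b : R3) : mink (lcross a b) b = 0 := by
  simp [mink, lcross]; ring

lemma mink_lcross_self (a b : R3) :
    mink (lcross a b) (lcross a b) = mink a b ^ 2 - mink a a * mink b b := by
  simp [mink, lcross]; ring

@[simp] lemma lcross_smul_right (s : ℝ) (a b : R3) : lcross a (s • b) = s • lcross a b :=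
  (lcrossL a).map_smul s b

@[simp] lemma lcross_neg_right (a b : R3) : lcross a (-b) = -lcross a b :=
  (lcrossL a).map_neg b

lemma lcross_lcross_left (a b : R3) :
    lcross a (lcross a b) = mink a a • b - mink a b • a := by
  ext i; fin_cases i <;> simp [mink, lcross] <;> ring

/-- The frame at `p ∈ ℍ²` formed by `p`, a unit tangent vector `u` and `J_p u`. -/
structure IsFrame (p u : R3) : Prop where
  pp : mink p p = -1
  uu : mink u u = 1
  pu : mink p u = 0

namespace IsFrame

variable {p u : R3} (h : IsFrame p u)
include h

lemma ee : mink (lcross p u) (lcross p u) = 1 := by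
  rw [mink_lcross_self, h.pp, h.uu, h.pu]; norm_num

/-- Expansion in the Lorentz-orthonormal basis `p, u, J_p u`. -/
lemma expand (x : R3) :
    x = -mink x p • p + mink x u • u + mink x (lcross p u) • lcross p u := by
  have key : (mink p u ^ 2 - mink p p * mink u u) • x =
      (mink p u * mink x u - mink u u * mink x p) • p +
      (mink p u * mink x p - mink p p * mink x u) • u
      + mink x (lcross p u) • lcross p u := by
    ext i; fin_cases i <;> simp [mink, lcross] <;> ring
  simpa [h.pp, h.uu, h.pu] using key

end IsFrame
/-! ### Calculus with the Lorentzian products -/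

lemma _root_.HasDerivAt.mink {a b : ℝ → R3} {a' b' : R3} {r : ℝ} (ha : HasDerivAt a a' r)
    (hb : HasDerivAt b b' r) :
    HasDerivAt (fun r => mink (a r) (b r)) (mink a' (b r) + mink (a r) b') r := by
  have := minkL.hasDerivAt_of_bilinear (fun _ => ha) (fun _ => hb)
  simpa [add_comm] using this

section

variable {E : Type*} [NormedAddCommGroup E] [NormedSpace ℝ E]

lemma _root_.HasFDerivAt.mink {a b : E → R3} {a' b' : E →L[ℝ] R3} {x : E}
    (ha : HasFDerivAt a a' x) (hb : HasFDerivAt b b' x) :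
    HasFDerivAt (fun x => mink (a x) (b x))
      ((minkL (a x)).comp b' + (minkL (b x)).comp a') x := by
  have := minkL.hasFDerivAt_of_bilinear ha hb
  refine this.congr_fderiv ?_
  ext X
  simp [mink_comm]

lemma _root_.ContDiffOn.mink {a b : E → R3} {s : Set E} {k : WithTop ℕ∞}
    (ha : ContDiffOn ℝ k a s) (hb : ContDiffOn ℝ k b s) :
    ContDiffOn ℝ k (fun x => mink (a x) (b x)) s :=
  minkL.isBoundedBilinearMap.contDiff.comp_contDiffOn (ha.prodMk hb)

lemma _root_.ContDiffOn.lcross {a b : E → R3} {s : Set E} {k : WithTop ℕ∞}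
    (ha : ContDiffOn ℝ k a s) (hb : ContDiffOn ℝ k b s) :
    ContDiffOn ℝ k (fun x => lcross (a x) (b x)) s :=
  lcrossL.isBoundedBilinearMap.contDiff.comp_contDiffOn (ha.prodMk hb)

end

/-! ### Tangent vectors of the hyperbolic plane -/

/-- Nonzero tangent vectors of `ℍ²` are spacelike. Such a vector is already nonzero in the coordinates
`1, 2`, and multiplying `⟨x, x⟩` by `p₀²` turns it into a sum of squares. -/
lemma mink_self_pos {p x : R3} (hp : mink p p = -1) (hx : mink p x = 0)
    (h : x 1 ≠ 0 ∨ x 2 ≠ 0) : 0 < mink x x := by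
  simp only [mink] at *
  have key : (p 0) ^ 2 * (-(x 0 * x 0) + x 1 * x 1 + x 2 * x 2)
      = (p 1 * x 2 - p 2 * x 1) ^ 2 + (x 1 ^ 2 + x 2 ^ 2) := by
    have h0 : p 0 * x 0 = p 1 * x 1 + p 2 * x 2 := by linarith
    have h1 : p 0 ^ 2 = 1 + p 1 ^ 2 + p 2 ^ 2 := by linarith
    linear_combination (-(p 0 * x 0) - (p 1 * x 1 + p 2 * x 2)) * h0 + (x 1 ^ 2 + x 2 ^ 2) * h1
  have h2 : 0 < x 1 ^ 2 + x 2 ^ 2 := by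
    rcases h with h | h
    · have := sq_pos_of_ne_zero h; nlinarith [sq_nonneg (x 2)]
    · have := sq_pos_of_ne_zero h; nlinarith [sq_nonneg (x 1)]
  have h3 : 0 < (p 0) ^ 2 * (-(x 0 * x 0) + x 1 * x 1 + x 2 * x 2) := by
    rw [key]; positivity
  exact pos_of_mul_pos_right h3 (sq_nonneg _)

/-- The geodesics issuing from a point of the upper sheet remain on the upper sheet. -/
lemma IsFrame.geodesic_pos {p u : R3} (h : IsFrame p u) (hp : 0 < p 0) (t : ℝ) :
    0 < (Real.cosh t • p + Real.sinh t • u) 0 := by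
  obtain ⟨h1, h2, h3⟩ := h
  simp only [mink, Pi.add_apply, Pi.smul_apply, smul_eq_mul] at *
  have h4 : u 0 ^ 2 < p 0 ^ 2 := by
    have h5 : p 0 * u 0 = p 1 * u 1 + p 2 * u 2 := by linarith
    have h6 : p 0 ^ 2 = 1 + p 1 ^ 2 + p 2 ^ 2 := by linarith
    have h7 : u 1 ^ 2 + u 2 ^ 2 = 1 + u 0 ^ 2 := by linarith
    have h8 : (p 0 * u 0) ^ 2 ≤ (p 1 ^ 2 + p 2 ^ 2) * (u 1 ^ 2 + u 2 ^ 2) := by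
      rw [h5]; nlinarith [sq_nonneg (p 1 * u 2 - p 2 * u 1)]
    rw [h7] at h8
    nlinarith
  have h9 : |u 0| < p 0 := by
    have := sq_lt_sq.1 h4
    rwa [abs_of_pos hp] at this
  have h10 : |Real.sinh t| < Real.cosh t := by
    rw [Real.abs_sinh, ← Real.cosh_abs t]
    exact Real.sinh_lt_cosh _
  have h11 : |Real.sinh t * u 0| < Real.cosh t * p 0 := by
    rw [abs_mul]
    exact mul_lt_mul'' h10 h9 (abs_nonneg _) (abs_nonneg _)
  have := (abs_lt.1 h11).1
  linarith

/-- Moving a frame by parallel transport along its geodesic. -/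
lemma IsFrame.boost {p u : R3} (h : IsFrame p u) (t : ℝ) :
    IsFrame (Real.cosh t • p + Real.sinh t • u) (Real.sinh t • p + Real.cosh t • u) := by
  have hc := Real.cosh_sq t
  have hup : mink u p = 0 := by rw [mink_comm]; exact h.pu
  constructor <;> simp [h.pp, h.uu, h.pu, hup]
  · linear_combination -hc
  · linear_combination hc
  · ring

lemma lcross_boost (p u : R3) (t : ℝ) :
    lcross (Real.cosh t • p + Real.sinh t • u) (Real.sinh t • p + Real.cosh t • u)
      = lcross p u := by
  have key : ∀ C S : ℝ, lcross (C • p + S • u) (S • p + C • u) = (C ^ 2 - S ^ 2) • lcross p u := by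
    intro C S
    ext i; fin_cases i <;> simp [lcross] <;> ring
  rw [key, Real.cosh_sq_sub_sinh_sq, one_smul]

open Set Filter Topology

/-! ### Interpolation of regular plane curves -/

/-- A `C¹` curve does not fill the plane, because its image has Hausdorff dimension at most one. -/
lemma exists_forall_ne_of_contDiffAt {f : ℝ → ℝ × ℝ} {t : Set ℝ}
    (hf : ∀ r ∈ t, ContDiffAt ℝ 1 f r) : ∃ w, ∀ r ∈ t, f r ≠ w := by
  have h1 : dimH (f '' t) ≤ dimH t := dimH_image_le_of_locally_lipschitzOn fun r hr => by
    obtain ⟨K, s, hs, hK⟩ := (hf r hr).exists_lipschitzOnWith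
    exact ⟨K, s, mem_nhdsWithin_of_mem_nhds hs, hK⟩
  have h2 : dimH (f '' t) < (Module.finrank ℝ (ℝ × ℝ) : ENNReal) := by
    refine lt_of_le_of_lt (h1.trans (dimH_mono (subset_univ t))) ?_
    rw [Real.dimH_univ]
    simp
  obtain ⟨w, hw⟩ := (dense_compl_of_dimH_lt_finrank h2).nonempty
  exact ⟨w, fun r hr h => hw ⟨r, hr, h⟩⟩

/-- Two regular plane curves on `(0, 1)` can be interpolated by a regular plane curve. The naive
interpolation with a cut-off function is corrected by a multiple `h • w` of a constant vector,
where `h' = 1` on the zone of interpolation and `w` avoids the one-parameter family of vectors that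
would produce a zero of the velocity. -/
lemma exists_regular_interpolation {a b : ℝ → ℝ × ℝ} (ha : ContDiffOn ℝ ∞ a (Ioo 0 1))
    (hb : ContDiffOn ℝ ∞ b (Ioo 0 1)) (ha' : ∀ r ∈ Ioo (0 : ℝ) 1, deriv a r ≠ 0)
    (hb' : ∀ r ∈ Ioo (0 : ℝ) 1, deriv b r ≠ 0) :
    ∃ τ : ℝ → ℝ × ℝ, ContDiffOn ℝ ∞ τ (Ioo 0 1) ∧ (∀ r ∈ Ioo (0 : ℝ) 1, deriv τ r ≠ 0) ∧
      (∀ r, r ≤ 1 / 4 → τ r = a r) ∧ ∀ r, 3 / 4 ≤ r → τ r = b r := by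
  let χ : ℝ → ℝ := fun r => Real.smoothTransition (4 * r - 3 / 2)
  have hχ : ContDiff ℝ ∞ χ := Real.smoothTransition.contDiff.comp (by fun_prop)
  have hχ0 : ∀ r, r ≤ 3 / 8 → χ r = 0 := fun r hr =>
    Real.smoothTransition.zero_of_nonpos (by linarith)
  have hχ1 : ∀ r, 5 / 8 ≤ r → χ r = 1 := fun r hr =>
    Real.smoothTransition.one_of_one_le (by linarith)
  let β : ContDiffBump (1 / 2 : ℝ) := ⟨3 / 16, 1 / 4, by norm_num, by norm_num⟩
  let h : ℝ → ℝ := fun r => β r * r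
  have hh : ContDiff ℝ ∞ h := β.contDiff.mul contDiff_id
  have hh0 : ∀ r, r ≤ 1 / 4 ∨ 3 / 4 ≤ r → h r = 0 := by
    intro r hr
    have : β r = 0 := by
      apply β.zero_of_le_dist
      rw [Real.dist_eq, le_abs]
      change (1 / 4 : ℝ) ≤ _ ∨ (1 / 4 : ℝ) ≤ _
      rcases hr with hr | hr
      · right; linarith
      · left; linarith
    simp [h, this]
  have hh1 : ∀ r ∈ Ioo (5 / 16 : ℝ) (11 / 16), deriv h r = 1 := by
    intro r hr
    have : h =ᶠ[𝓝 r] id := by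
      filter_upwards [isOpen_Ioo.mem_nhds hr] with x hx
      have : β x = 1 := by
        apply β.one_of_mem_closedBall
        rw [Metric.mem_closedBall, Real.dist_eq, abs_le]
        change -(3 / 16 : ℝ) ≤ _ ∧ _ ≤ (3 / 16 : ℝ)
        constructor <;> linarith [hx.1, hx.2]
      simp [h, this]
    rw [this.deriv_eq]; simp
  let σ : ℝ → ℝ × ℝ := fun r => a r + χ r • (b r - a r)
  have hσ : ContDiffOn ℝ ∞ σ (Ioo 0 1) := ha.add (hχ.contDiffOn.smul (hb.sub ha))
  have hσa : ∀ r, r ≤ 3 / 8 → σ r = a r := fun r hr => by simp [σ, hχ0 r hr]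
  have hσb : ∀ r, 5 / 8 ≤ r → σ r = b r := fun r hr => by simp [σ, hχ1 r hr]
  have hσ' : ContDiffOn ℝ ∞ (deriv σ) (Ioo 0 1) := hσ.deriv_of_isOpen isOpen_Ioo (by simp)
  have hh' : ContDiff ℝ ∞ (deriv h) := (contDiff_infty_iff_deriv.1 hh).2
  obtain ⟨w, hw⟩ := exists_forall_ne_of_contDiffAt
    (f := fun r => (deriv h r)⁻¹ • -deriv σ r) (t := {r ∈ Ioo (0 : ℝ) 1 | deriv h r ≠ 0}) (by
      rintro r ⟨hr, hr'⟩
      exact (((hh'.contDiffAt.inv hr').smul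
        (hσ'.contDiffAt (isOpen_Ioo.mem_nhds hr)).neg)).of_le (by exact_mod_cast le_top))
  refine ⟨fun r => σ r + h r • w, hσ.add (hh.contDiffOn.smul contDiffOn_const), ?_, ?_, ?_⟩
  · intro r hr
    have hd1 : HasDerivAt σ (deriv σ r) r :=
      ((hσ.contDiffAt (isOpen_Ioo.mem_nhds hr)).differentiableAt (by simp)).hasDerivAt
    have hd2 : HasDerivAt h (deriv h r) r :=
      (hh.contDiffAt.differentiableAt (by simp)).hasDerivAt
    rw [(hd1.fun_add (hd2.smul_const w)).deriv]
    -- where `h' = 0` the curve is away from the zone of interpolation, hence regular by assumption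
    by_cases h0 : deriv h r = 0
    · have hr' : r ∉ Ioo (5 / 16 : ℝ) (11 / 16) := fun hr' => by simp [hh1 r hr'] at h0
      rw [h0, zero_smul, add_zero]
      rcases lt_or_ge r (3 / 8) with h3 | h3
      · have : σ =ᶠ[𝓝 r] a := by
          filter_upwards [Iio_mem_nhds h3] with x hx using hσa x (le_of_lt hx)
        rw [this.deriv_eq]; exact ha' r hr
      · have h4 : 5 / 8 < r := by
          by_contra hc
          exact hr' ⟨by linarith, by linarith⟩
        have : σ =ᶠ[𝓝 r] b := by
          filter_upwards [Ioi_mem_nhds h4] with x hx using hσb x (le_of_lt hx)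
        rw [this.deriv_eq]; exact hb' r hr
    · intro hc
      refine hw r ⟨hr, h0⟩ ?_
      rw [eq_comm, eq_inv_smul_iff₀ h0]
      exact eq_neg_of_add_eq_zero_right hc
  · intro r hr
    simp [hσa r (by linarith), hh0 r (Or.inl hr)]
  · intro r hr
    simp [hσb r (by linarith), hh0 r (Or.inr hr)]

/-- A sequence of germs of regular plane curves is carried by one regular plane curve. -/
lemma exists_regular_curve_through (σ : ℤ → ℝ → ℝ × ℝ)
    (hσ : ∀ i, ContDiffOn ℝ ∞ (σ i) (Ioo (-1) 1))
    (hσ' : ∀ i, ∀ r ∈ Ioo (-1 : ℝ) 1, deriv (σ i) r ≠ 0) :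
    ∃ G : ℝ → ℝ × ℝ, ContDiff ℝ ∞ G ∧ (∀ r, deriv G r ≠ 0) ∧
      ∀ (i : ℤ) (r : ℝ), |r| < 1 / 4 → G (i + r) = σ i r := by
  have hshift : ∀ i, ContDiffOn ℝ ∞ (fun r => σ i (r - 1)) (Ioo 0 1) := fun i =>
    (hσ i).comp (by fun_prop) (fun r hr => ⟨by linarith [hr.1], by linarith [hr.2]⟩)
  have hgap : ∀ i : ℤ, _ := fun i => exists_regular_interpolation
    ((hσ i).mono (Ioo_subset_Ioo_left (by norm_num))) (hshift (i + 1))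
    (fun r hr => hσ' i r ⟨by linarith [hr.1], hr.2⟩)
    (fun r hr => by
      rw [deriv_comp_sub_const]
      exact hσ' (i + 1) _ ⟨by linarith [hr.1], by linarith [hr.2]⟩)
  choose τ hτ hτ' hτa hτb using hgap
  -- the `i`-th germ sits at the integer `i`, and `τ i` fills the gap between `i` and `i + 1`
  let G : ℝ → ℝ × ℝ := fun r => if Int.fract r = 0 then σ ⌊r⌋ 0 else τ ⌊r⌋ (Int.fract r)
  have hGgap : ∀ (i : ℤ) (r : ℝ), r ∈ Ioo (0 : ℝ) 1 → G (i + r) = τ i r := by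
    intro i r hr
    have hf : Int.fract r = r := Int.fract_eq_self.2 ⟨hr.1.le, hr.2⟩
    have hfl : ⌊r⌋ = 0 := Int.floor_eq_zero_iff.2 ⟨hr.1.le, hr.2⟩
    simp [G, hf, hfl, hr.1.ne']
  have hGslot : ∀ (i : ℤ) (r : ℝ), |r| < 1 / 4 → G (i + r) = σ i r := by
    intro i r hr
    rw [abs_lt] at hr
    rcases lt_trichotomy r 0 with h | h | h
    · have h1 : ((i : ℝ) + r) = ((i - 1 : ℤ) : ℝ) + (r + 1) := by push_cast; ring
      rw [h1, hGgap _ _ ⟨by linarith, by linarith⟩, hτb _ _ (by linarith)]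
      simp
    · simp [h, G]
    · rw [hGgap _ _ ⟨h, by linarith⟩, hτa _ _ (by linarith)]
  have hcover : ∀ r : ℝ, (∃ i : ℤ, |r - i| < 1 / 4) ∨ ∃ i : ℤ, r - i ∈ Ioo (0 : ℝ) 1 := by
    intro r
    rcases (Int.fract_nonneg r).eq_or_lt with h | h
    · refine Or.inl ⟨⌊r⌋, ?_⟩
      rw [Int.self_sub_floor, ← h]; norm_num
    · exact Or.inr ⟨⌊r⌋, by rw [Int.self_sub_floor]; exact ⟨h, Int.fract_lt_one r⟩⟩
  have hslot_nhds : ∀ (i : ℤ) (r : ℝ), |r - i| < 1 / 4 → G =ᶠ[𝓝 r] fun x => σ i (x - i) := by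
    intro i r hr
    have : IsOpen {x : ℝ | |x - i| < 1 / 4} := isOpen_lt (by fun_prop) (by fun_prop)
    filter_upwards [this.mem_nhds hr] with x hx
    simpa using hGslot i (x - i) hx
  have hgap_nhds : ∀ (i : ℤ) (r : ℝ), r - i ∈ Ioo (0 : ℝ) 1 →
      G =ᶠ[𝓝 r] fun x => τ i (x - i) := by
    intro i r hr
    have : IsOpen ((fun x : ℝ => x - i) ⁻¹' Ioo 0 1) := isOpen_Ioo.preimage (by fun_prop)
    filter_upwards [this.mem_nhds hr] with x hx
    simpa using hGgap i (x - i) hx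
  refine ⟨G, contDiff_iff_contDiffAt.2 fun r => ?_, fun r => ?_, hGslot⟩
  · rcases hcover r with ⟨i, hi⟩ | ⟨i, hi⟩
    · refine ContDiffAt.congr_of_eventuallyEq ?_ (hslot_nhds i r hi)
      rw [abs_lt] at hi
      exact ((hσ i).contDiffAt (isOpen_Ioo.mem_nhds
        ⟨by linarith, by linarith⟩)).comp r (contDiffAt_id.sub contDiffAt_const)
    · refine ContDiffAt.congr_of_eventuallyEq ?_ (hgap_nhds i r hi)
      exact ((hτ i).contDiffAt (isOpen_Ioo.mem_nhds hi)).comp r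
        (contDiffAt_id.sub contDiffAt_const)
  · rcases hcover r with ⟨i, hi⟩ | ⟨i, hi⟩
    · rw [(hslot_nhds i r hi).deriv_eq, deriv_comp_sub_const]
      rw [abs_lt] at hi
      exact hσ' i _ ⟨by linarith, by linarith⟩
    · rw [(hgap_nhds i r hi).deriv_eq, deriv_comp_sub_const]
      exact hτ' i _ hi

/-! ### Frenet curves of the hyperbolic plane -/

/-- A smooth arc-length curve `γ` of `ℍ²` with its unit normal field `n`, the orientation of `n`
being fixed by `γ' = J n`. -/
structure IsFrenetCurve (I : Set ℝ) (γ n : ℝ → R3) : Prop where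
  smooth : ContDiffOn ℝ ∞ γ I
  smooth_normal : ContDiffOn ℝ ∞ n I
  frame : ∀ r ∈ I, IsFrame (γ r) (n r)
  pos : ∀ r ∈ I, 0 < γ r 0
  hasDerivAt : ∀ r ∈ I, HasDerivAt γ (lcross (γ r) (n r)) r

lemma IsFrenetCurve.isCurveWithNormal {I : Set ℝ} {γ n : ℝ → R3} (h : IsFrenetCurve I γ n)
    (ho : IsOpen I) (hc : IsConnected I) :
    IsCurveWithNormal I γ n (fun r => mink (deriv (deriv γ) r) (n r)) where
  isOpen := ho
  isConnected := hc
  smooth := h.smooth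
  smooth_normal := h.smooth_normal
  mem r hr := ⟨(h.frame r hr).pp, h.pos r hr⟩
  unit_speed r hr := by rw [(h.hasDerivAt r hr).deriv]; exact (h.frame r hr).ee
  normal_tangent r hr := by rw [mink_comm]; exact (h.frame r hr).pu
  normal_unit r hr := (h.frame r hr).uu
  normal_orthogonal r hr := by rw [(h.hasDerivAt r hr).deriv, mink_comm]; simp
  curvature _ _ := rfl

/-- The velocity of a curve of `ℍ²` is tangent to `ℍ²`. -/
lemma mink_deriv_eq_zero {Γ : ℝ → R3} {Γ' : R3} {r : ℝ} (h : ∀ᶠ x in 𝓝 r, mink (Γ x) (Γ x) = -1)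
    (hd : HasDerivAt Γ Γ' r) : mink (Γ r) Γ' = 0 := by
  have h1 := hd.mink hd
  have h2 : HasDerivAt (fun x => mink (Γ x) (Γ x)) 0 r :=
    (hasDerivAt_const r (-1 : ℝ)).congr_of_eventuallyEq h
  have h3 := h1.unique h2
  rw [mink_comm Γ'] at h3
  linarith

/-- Arc-length parametrization of a regular curve of `ℍ²` defined on the whole line: `S` is the
arc length and `R` its inverse function. -/
lemma exists_arcLength {Γ : ℝ → R3} (hΓ : ContDiff ℝ ∞ Γ) (hH : ∀ r, Γ r ∈ H2)
    (hreg : ∀ r, 0 < mink (deriv Γ r) (deriv Γ r)) :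
    ∃ S R : ℝ → ℝ, (∀ r, HasDerivAt S (√(mink (deriv Γ r) (deriv Γ r))) r) ∧
      (∀ r, R (S r) = r) ∧ IsOpen (range S) ∧ IsConnected (range S) ∧
      IsFrenetCurve (range S) (fun x => Γ (R x))
        (fun x => (√(mink (deriv Γ (R x)) (deriv Γ (R x))))⁻¹ •
          -lcross (Γ (R x)) (deriv Γ (R x))) := by
  set v : ℝ → ℝ := fun r => √(mink (deriv Γ r) (deriv Γ r)) with hv
  have hv0 : ∀ r, 0 < v r := fun r => Real.sqrt_pos.2 (hreg r)
  have hΓ' : ContDiff ℝ ∞ (deriv Γ) := (contDiff_infty_iff_deriv.1 hΓ).2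
  have hvs : ContDiff ℝ ∞ v := by
    refine ContDiff.sqrt ?_ (fun r => (hreg r).ne')
    exact contDiffOn_univ.1 (hΓ'.contDiffOn.mink hΓ'.contDiffOn)
  let S : ℝ → ℝ := fun r => ∫ x in (0 : ℝ)..r, v x
  have hS : ∀ r, HasDerivAt S (v r) r := fun r => by
    exact (hvs.continuous.integral_hasStrictDerivAt 0 r).hasDerivAt
  have hdS : deriv S = v := funext fun r => (hS r).deriv
  have hSs : ContDiff ℝ ∞ S := by
    rw [contDiff_infty_iff_deriv]
    exact ⟨fun r => (hS r).differentiableAt, hdS ▸ hvs⟩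
  have hmono : StrictMono S := strictMono_of_deriv_pos (fun r => by rw [hdS]; exact hv0 r)
  have hopen : IsOpenMap S := isOpenMap_of_hasStrictDerivAt
    (fun x => hvs.continuous.integral_hasStrictDerivAt 0 x) (fun x => (hv0 x).ne')
  have hemb : IsOpenEmbedding S :=
    .of_continuous_injective_isOpenMap hSs.continuous hmono.injective hopen
  let e := hemb.toOpenPartialHomeomorph S
  have hRS : ∀ r, e.symm (S r) = r := fun r => hemb.toOpenPartialHomeomorph_left_inv
  have hRs : ∀ r, ContDiffAt ℝ ∞ e.symm (S r) := fun r => by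
    refine e.contDiffAt_symm_deriv (f₀' := v r) (hv0 r).ne' (by simp [e]) ?_ ?_
    · rw [hRS]; exact hS r
    · exact hSs.contDiffAt
  have hRd : ∀ r, HasDerivAt e.symm (v r)⁻¹ (S r) := fun r => by
    refine e.hasDerivAt_symm (by simp [e]) (hv0 r).ne' ?_
    rw [hRS]; exact hS r
  have hRso : ContDiffOn ℝ ∞ e.symm (range S) := by
    rintro _ ⟨r, rfl⟩
    exact (hRs r).contDiffWithinAt
  have htan : ∀ r, mink (Γ r) (deriv Γ r) = 0 := fun r =>
    mink_deriv_eq_zero (Eventually.of_forall fun x => (hH x).1)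
      (hΓ.differentiable (by simp) r).hasDerivAt
  have hsq : ∀ r, mink (deriv Γ r) (deriv Γ r) = v r ^ 2 := fun r =>
    (Real.sq_sqrt (hreg r).le).symm
  refine ⟨S, e.symm, hS, hRS, hopen.isOpen_range, isConnected_range hSs.continuous, ?_⟩
  constructor
  · exact hΓ.comp_contDiffOn hRso
  · refine ContDiffOn.smul ((hvs.comp_contDiffOn hRso).inv fun x _ => (hv0 _).ne') ?_
    exact ((hΓ.comp_contDiffOn hRso).lcross (hΓ'.comp_contDiffOn hRso)).neg
  · rintro _ ⟨r, rfl⟩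
    simp only [hRS]
    refine ⟨(hH r).1, ?_, ?_⟩
    · have h1 := mink_lcross_self (Γ r) (deriv Γ r)
      rw [htan, (hH r).1, hsq] at h1
      have := (hv0 r).ne'
      have hvr : √(mink (deriv Γ r) (deriv Γ r)) = v r := rfl
      simp only [mink_smul_left, mink_smul_right, mink_neg_left, mink_neg_right, h1, hvr]
      field_simp
      ring
    · have h1 : mink (Γ r) (lcross (Γ r) (deriv Γ r)) = 0 := by rw [mink_comm]; simp
      rw [mink_smul_right, mink_neg_right, h1]; simp
  · rintro _ ⟨r, rfl⟩
    simpa only [hRS] using (hH r).2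
  · rintro _ ⟨r, rfl⟩
    have h1 : HasDerivAt Γ (deriv Γ r) (e.symm (S r)) := by
      rw [hRS]; exact (hΓ.differentiable (by simp) r).hasDerivAt
    refine (h1.scomp (S r) (hRd r)).congr_deriv ?_
    simp only [hRS]
    rw [lcross_smul_right, lcross_neg_right, lcross_lcross_left, htan, (hH r).1]
    simp [hv]

/-- The point of `ℍ²` with given spacelike coordinates. -/
noncomputable def lift (y : ℝ × ℝ) : R3 := ![√(1 + y.1 ^ 2 + y.2 ^ 2), y.1, y.2]

lemma lift_mem (y : ℝ × ℝ) : lift y ∈ H2 := by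
  have h : 0 < 1 + y.1 ^ 2 + y.2 ^ 2 := by positivity
  refine ⟨?_, ?_⟩
  · have := Real.mul_self_sqrt h.le
    simp [mink, lift]
    linarith
  · simpa [lift] using h

lemma contDiff_lift : ContDiff ℝ ∞ lift := by
  rw [contDiff_pi]
  intro i
  fin_cases i
  · refine ContDiff.sqrt (by fun_prop) fun y => ?_
    have h : 0 < 1 + y.1 ^ 2 + y.2 ^ 2 := by positivity
    exact h.ne'
  · exact contDiff_fst
  · exact contDiff_snd

lemma lift_coord {x : R3} (hx : x ∈ H2) : lift (x 1, x 2) = x := by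
  obtain ⟨h1, h2⟩ := hx
  simp only [mink] at h1
  ext i; fin_cases i
  · have : 1 + x 1 ^ 2 + x 2 ^ 2 = x 0 ^ 2 := by linarith
    simp only [lift, Fin.zero_eta, Matrix.cons_val_zero]
    rw [this, Real.sqrt_sq h2.le]
  · rfl
  · rfl

/-- A sequence of Frenet curves can be strung along a single Frenet curve: the `i`-th curve is found
around the parameter `a i`, restricted to a quarter of its interval of definition. It matters that
this fraction does not depend on the curves, since it has to be known when a covering is chosen. -/
lemma exists_isFrenetCurve_through (γ n : ℕ → ℝ → R3) (ε : ℕ → ℝ) (hε : ∀ i, 0 < ε i)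
    (h : ∀ i, IsFrenetCurve (Ioo (-ε i) (ε i)) (γ i) (n i)) :
    ∃ (I : Set ℝ) (Γ ν : ℝ → R3) (a : ℕ → ℝ), IsOpen I ∧ IsConnected I ∧ IsFrenetCurve I Γ ν ∧
      (∀ i ρ, |ρ| < ε i / 4 → a i + ρ ∈ I ∧ Γ (a i + ρ) = γ i ρ ∧ ν (a i + ρ) = n i ρ) ∧
      ∀ i j ρ ρ', |ρ| < ε i / 4 → |ρ'| < ε j / 4 → a i + ρ = a j + ρ' → i = j := by
  have hmaps : ∀ i, MapsTo (fun r => ε i * r) (Ioo (-1) 1) (Ioo (-ε i) (ε i)) := fun i r hr =>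
    ⟨by nlinarith [hε i, hr.1], by nlinarith [hε i, hr.2]⟩
  have hs : ∀ i, ContDiffOn ℝ ∞ (fun r => γ i (ε i * r)) (Ioo (-1) 1) := fun i =>
    (h i).smooth.comp (by fun_prop) (hmaps i)
  -- rescaled to `(-1, 1)`, so that the `i`-th curve has constant speed `ε i`; the germs at negative
  -- integers are irrelevant
  let σ : ℤ → ℝ → ℝ × ℝ := fun i r => (γ i.toNat (ε i.toNat * r) 1, γ i.toNat (ε i.toNat * r) 2)
  have hσ : ∀ i, ContDiffOn ℝ ∞ (σ i) (Ioo (-1) 1) := fun i =>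
    (contDiffOn_pi.1 (hs _) 1).prodMk (contDiffOn_pi.1 (hs _) 2)
  have hder : ∀ i : ℕ, ∀ r ∈ Ioo (-1 : ℝ) 1, HasDerivAt (fun r => γ i (ε i * r))
      (ε i • lcross (γ i (ε i * r)) (n i (ε i * r))) r := fun i r hr => by
    have h1 := (h i).hasDerivAt _ (hmaps i hr)
    have h2 : HasDerivAt (fun r => ε i * r) (ε i) r := by
      simpa using (hasDerivAt_id r).const_mul (ε i)
    exact h1.scomp r h2
  have hσ' : ∀ i, ∀ r ∈ Ioo (-1 : ℝ) 1, deriv (σ i) r ≠ 0 := by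
    intro i r hr hc
    have h1 := hasDerivAt_pi.1 (hder i.toNat r hr)
    have h2 : HasDerivAt (σ i) _ r := (h1 1).prodMk (h1 2)
    rw [h2.deriv] at hc
    have hε' := (hε i.toNat).ne'
    have h3 := congrArg Prod.fst hc
    have h4 := congrArg Prod.snd hc
    simp only [Pi.smul_apply, smul_eq_mul, Prod.fst_zero, Prod.snd_zero, mul_eq_zero, hε',
      false_or] at h3 h4
    have h5 := ((h i.toNat).frame _ (hmaps _ hr)).ee
    -- a unit spacelike vector cannot be proportional to the timelike coordinate axis
    rw [mink, h3, h4] at h5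
    nlinarith [sq_nonneg (lcross (γ i.toNat (ε i.toNat * r)) (n i.toNat (ε i.toNat * r)) 0)]
  obtain ⟨G, hG, hG', hGσ⟩ := exists_regular_curve_through σ hσ hσ'
  have hΓs : ContDiff ℝ ∞ (fun r => lift (G r)) := contDiff_lift.comp hG
  set Γ : ℝ → R3 := fun r => lift (G r) with hΓdef
  have hreg : ∀ r, 0 < mink (deriv Γ r) (deriv Γ r) := by
    intro r
    have hd : HasDerivAt Γ (deriv Γ r) r := (hΓs.differentiable (by simp) r).hasDerivAt
    have htan := mink_deriv_eq_zero (Eventually.of_forall fun x => (lift_mem (G x)).1) hd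
    refine mink_self_pos (lift_mem (G r)).1 htan ?_
    by_contra! hc
    apply hG' r
    have h1 := hasDerivAt_pi.1 hd
    have h2 : HasDerivAt G (deriv Γ r 1, deriv Γ r 2) r := (h1 1).prodMk (h1 2)
    rw [h2.deriv, hc.1, hc.2]; rfl
  obtain ⟨S, R, hS, hRS, ho, hc, hF⟩ := exists_arcLength hΓs (fun r => lift_mem (G r)) hreg
  have hΓγ : ∀ (i : ℕ) (r : ℝ), |r| < 1 / 4 → Γ (i + r) = γ i (ε i * r) := by
    intro i r hr
    have h1 := hGσ i r hr
    rw [Int.cast_natCast] at h1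
    rw [hΓdef]
    simp only [h1, σ, Int.toNat_natCast]
    have hr' : r ∈ Ioo (-1 : ℝ) 1 := by
      rw [abs_lt] at hr; exact ⟨by linarith, by linarith⟩
    exact lift_coord ⟨((h i).frame _ (hmaps i hr')).pp, (h i).pos _ (hmaps i hr')⟩
  have hΓd : ∀ (i : ℕ) (r : ℝ), |r| < 1 / 4 →
      deriv Γ (i + r) = ε i • lcross (γ i (ε i * r)) (n i (ε i * r)) := by
    intro i r hr
    have hr' : r ∈ Ioo (-1 : ℝ) 1 := by
      rw [abs_lt] at hr; exact ⟨by linarith, by linarith⟩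
    rw [← deriv_comp_const_add (f := Γ), ← (hder i r hr').deriv]
    apply Filter.EventuallyEq.deriv_eq
    have : IsOpen {x : ℝ | |x| < 1 / 4} := isOpen_lt (by fun_prop) (by fun_prop)
    filter_upwards [this.mem_nhds hr] with x hx using hΓγ i x hx
  have hspeed : ∀ (i : ℕ) (r : ℝ), |r| < 1 / 4 →
      √(mink (deriv Γ (i + r)) (deriv Γ (i + r))) = ε i := by
    intro i r hr
    have hr' : r ∈ Ioo (-1 : ℝ) 1 := by
      rw [abs_lt] at hr; exact ⟨by linarith, by linarith⟩
    rw [hΓd i r hr, mink_smul_left, mink_smul_right, ((h i).frame _ (hmaps i hr')).ee, mul_one,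
      Real.sqrt_mul_self (hε i).le]
  have hSlin : ∀ (i : ℕ) (r : ℝ), |r| < 1 / 4 → S (i + r) = S i + ε i * r := by
    intro i r hr
    have hd : ∀ x : ℝ, |x| < 1 / 4 → HasDerivAt (fun x => S (i + x) - ε i * x) 0 x := by
      intro x hx
      have h1 := (hS (i + x)).comp_const_add (i : ℝ) x
      rw [hspeed i x hx] at h1
      simpa using h1.fun_sub ((hasDerivAt_id x).const_mul (ε i))
    have h0 : Ioo (-(1 / 4) : ℝ) (1 / 4) = {x | |x| < 1 / 4} := by ext x; simp [abs_lt]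
    have := isOpen_Ioo.is_const_of_deriv_eq_zero (convex_Ioo (-(1 / 4) : ℝ) (1 / 4)).isPreconnected
      (f := fun x => S (i + x) - ε i * x)
      (fun x hx => (hd x (by rwa [h0] at hx)).differentiableAt.differentiableWithinAt)
      (fun x hx => (hd x (by rwa [h0] at hx)).deriv)
      (x := r) (y := 0) (by rw [h0]; exact hr) (by norm_num)
    simp only [add_zero, mul_zero, sub_zero] at this
    linarith
  have hpar : ∀ (i : ℕ) (ρ : ℝ), |ρ| < ε i / 4 → |ρ / ε i| < 1 / 4 ∧ S (i + ρ / ε i) = S i + ρ := by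
    intro i ρ hρ
    have h1 : |ρ / ε i| < 1 / 4 := by
      rw [abs_div, abs_of_pos (hε i), div_lt_iff₀ (hε i)]; linarith
    refine ⟨h1, ?_⟩
    rw [hSlin i _ h1, mul_div_cancel₀ _ (hε i).ne']
  refine ⟨range S, _, _, fun i => S i, ho, hc, hF, ?_, ?_⟩
  · intro i ρ hρ
    obtain ⟨h1, h2⟩ := hpar i ρ hρ
    have hr' : ρ ∈ Ioo (-ε i) (ε i) := by
      rw [abs_lt] at hρ; have := hε i; exact ⟨by linarith, by linarith⟩
    refine ⟨⟨_, h2⟩, ?_, ?_⟩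
    · simp only [← h2, hRS]
      rw [hΓγ i _ h1, mul_div_cancel₀ _ (hε i).ne']
    · simp only [← h2, hRS]
      have hf := (h i).frame ρ hr'
      rw [hspeed i _ h1, hΓd i _ h1, hΓγ i _ h1, mul_div_cancel₀ _ (hε i).ne', lcross_smul_right,
        ← smul_neg, inv_smul_smul₀ (hε i).ne', lcross_lcross_left, hf.pp, hf.pu]
      simp
  · intro i j ρ ρ' hρ hρ' hij
    obtain ⟨h1, h2⟩ := hpar i ρ hρ
    obtain ⟨h3, h4⟩ := hpar j ρ' hρ'
    have h5 := congrArg R (h2.trans (hij.trans h4.symm))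
    rw [hRS, hRS] at h5
    rw [abs_lt] at h1 h3
    have h6 : (i : ℝ) < (j + 1 : ℕ) := by push_cast; linarith
    have h7 : (j : ℝ) < (i + 1 : ℕ) := by push_cast; linarith
    have h8 := Nat.cast_lt.1 h6
    have h9 := Nat.cast_lt.1 h7
    omega

/-! ### Geodesic fields along a map to the hyperbolic plane -/

section LocalStructure

variable {E : Type*} [NormedAddCommGroup E] [NormedSpace ℝ E]

/-- The derivative of the `1`-form `⟨a, db⟩`. -/
lemma hasFDerivAt_minkL_comp_fderiv {a b : E → R3} {x : E} (ha : ContDiffAt ℝ ∞ a x)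
    (hb : ContDiffAt ℝ ∞ b x) :
    ∃ D : E →L[ℝ] E →L[ℝ] ℝ, HasFDerivAt (fun x => (minkL (a x)).comp (fderiv ℝ b x)) D x ∧
      ∀ X Y, D X Y = mink (fderiv ℝ a x X) (fderiv ℝ b x Y) +
        mink (a x) (fderiv ℝ (fderiv ℝ b) x X Y) := by
  have h1 : HasFDerivAt (fun x => minkL (a x)) (minkL.comp (fderiv ℝ a x)) x :=
    minkL.hasFDerivAt.comp x (ha.differentiableAt (by simp)).hasFDerivAt
  have h2 : HasFDerivAt (fderiv ℝ b) (fderiv ℝ (fderiv ℝ b) x) x :=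
    ((hb.fderiv_right (m := ∞) (by simp)).differentiableAt (by simp)).hasFDerivAt
  refine ⟨_, h1.clm_comp h2, fun X Y => ?_⟩
  simp [add_comm]

lemma fderiv_fderiv_symm {b : E → R3} {x : E} (hb : ContDiffAt ℝ ∞ b x) (X Y : E) :
    fderiv ℝ (fderiv ℝ b) x X Y = fderiv ℝ (fderiv ℝ b) x Y X :=
  (hb.isSymmSndFDerivAt (by simpa using ENat.LEInfty.out)) X Y

/-- The `1`-form `⟨a, db⟩` has a primitive as soon as `⟨da, db⟩` is symmetric. -/
lemma exists_primitive {a b : E → R3} {W : Set E} (hW : IsOpen W) (hWc : Convex ℝ W)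
    (ha : ContDiffOn ℝ ∞ a W) (hb : ContDiffOn ℝ ∞ b W)
    (hsymm : ∀ x ∈ W, ∀ X Y, mink (fderiv ℝ a x X) (fderiv ℝ b x Y) =
      mink (fderiv ℝ a x Y) (fderiv ℝ b x X)) (x₀ : E) :
    ∃ T : E → ℝ, T x₀ = 0 ∧ ContDiffOn ℝ ∞ T W ∧
      ∀ x ∈ W, HasFDerivAt T ((minkL (a x)).comp (fderiv ℝ b x)) x := by
  have hD := fun x (hx : x ∈ W) => hasFDerivAt_minkL_comp_fderiv
    (ha.contDiffAt (hW.mem_nhds hx)) (hb.contDiffAt (hW.mem_nhds hx))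
  have hωd : DifferentiableOn ℝ (fun x => (minkL (a x)).comp (fderiv ℝ b x)) W := fun x hx => by
    obtain ⟨D, h, -⟩ := hD x hx
    exact h.differentiableAt.differentiableWithinAt
  obtain ⟨T, hT⟩ := hWc.exists_forall_hasFDerivAt_of_fderiv_symmetric hW hωd
    (fun x hx X Y => by
      obtain ⟨D, h, h'⟩ := hD x hx
      rw [h.fderiv, h', h', hsymm x hx, fderiv_fderiv_symm (hb.contDiffAt (hW.mem_nhds hx))])
  refine ⟨fun x => T x - T x₀, sub_self _, ?_, fun x hx => (hT x hx).sub_const _⟩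
  rw [contDiffOn_infty_iff_fderiv_of_isOpen hW]
  refine ⟨fun x hx => ((hT x hx).sub_const _).differentiableAt.differentiableWithinAt, ?_⟩
  have hω : ContDiffOn ℝ ∞ (fun x => (minkL (a x)).comp (fderiv ℝ b x)) W :=
    (minkL.contDiff.comp_contDiffOn ha).clm_comp (hb.fderiv_of_isOpen hW (by simp))
  exact hω.congr fun x hx => ((hT x hx).sub_const _).fderiv

/-- A unit tangent field `u` along a map `p` to `ℍ²` whose covariant derivative is
`∇u = k ⟨J u, dp⟩ J u`. When `p` is a submersion, this says that `u` is locally the pull-back of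
a unit vector field of `ℍ²` all of whose integral curves are geodesics. -/
structure IsGeodesicField (W : Set E) (p u : E → R3) : Prop where
  smooth : ContDiffOn ℝ ∞ p W
  smooth_field : ContDiffOn ℝ ∞ u W
  frame : ∀ x ∈ W, IsFrame (p x) (u x)
  pos : ∀ x ∈ W, 0 < p x 0
  fderiv_field : ∀ x ∈ W, ∃ k : ℝ, ∀ X, fderiv ℝ u x X = mink (u x) (fderiv ℝ p x X) • p x +
    (k * mink (lcross (p x) (u x)) (fderiv ℝ p x X)) • lcross (p x) (u x)

/-- The differential of a map to `ℍ²` is orthogonal to the position vector. -/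
lemma mink_fderiv_eq_zero {p : E → R3} {p' : E →L[ℝ] R3} {x : E}
    (h : ∀ᶠ y in 𝓝 x, mink (p y) (p y) = -1) (hp : HasFDerivAt p p' x) (X : E) :
    mink (p x) (p' X) = 0 := by
  have h1 := (hp.mink hp).unique ((hasFDerivAt_const (-1 : ℝ) x).congr_of_eventuallyEq h)
  have h2 := congrArg (fun L : E →L[ℝ] ℝ => L X) h1
  simp at h2
  linarith

namespace IsGeodesicField

variable {W : Set E} {p u : E → R3} (h : IsGeodesicField W p u) (hW : IsOpen W)
include h

lemma mono {W' : Set E} (hW' : W' ⊆ W) : IsGeodesicField W' p u :=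
  ⟨h.smooth.mono hW', h.smooth_field.mono hW', fun x hx => h.frame x (hW' hx),
    fun x hx => h.pos x (hW' hx), fun x hx => h.fderiv_field x (hW' hx)⟩

include hW

lemma hasFDerivAt {x : E} (hx : x ∈ W) : HasFDerivAt p (fderiv ℝ p x) x :=
  ((h.smooth.contDiffAt (hW.mem_nhds hx)).differentiableAt (by simp)).hasFDerivAt

lemma hasFDerivAt_field {x : E} (hx : x ∈ W) : HasFDerivAt u (fderiv ℝ u x) x :=
  ((h.smooth_field.contDiffAt (hW.mem_nhds hx)).differentiableAt (by simp)).hasFDerivAt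

lemma mink_fderiv {x : E} (hx : x ∈ W) (X : E) : mink (p x) (fderiv ℝ p x X) = 0 :=
  mink_fderiv_eq_zero (by filter_upwards [hW.mem_nhds hx] with y hy using (h.frame y hy).pp)
    (h.hasFDerivAt hW hx) X

/-- The potential of a geodesic field: a signed distance function pulled back by `p`. -/
lemma exists_potential (hWc : Convex ℝ W) (x₀ : E) :
    ∃ T : E → ℝ, T x₀ = 0 ∧ ContDiffOn ℝ ∞ T W ∧
      ∀ x ∈ W, HasFDerivAt T ((minkL (u x)).comp (fderiv ℝ p x)) x := by
  refine exists_primitive hW hWc h.smooth_field h.smooth (fun x hx X Y => ?_) x₀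
  obtain ⟨k, hk⟩ := h.fderiv_field x hx
  rw [hk, hk]
  simp only [mink_add_left, mink_smul_left, h.mink_fderiv hW hx]
  ring

/-- Following the geodesics of the field back by the time `T`, where `T` is its potential, leads
to a frame `(cosh T p - sinh T u, -sinh T p + cosh T u)` which moves in one direction only; the
arc length `ρ` of the motion is a function of the point. -/
lemma exists_arcLength_of_footpoint (hWc : Convex ℝ W) (x₀ : E) {T : E → ℝ}
    (hTs : ContDiffOn ℝ ∞ T W)
    (hT : ∀ x ∈ W, HasFDerivAt T ((minkL (u x)).comp (fderiv ℝ p x)) x) :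
    ∃ ρ : E → ℝ, ρ x₀ = 0 ∧ ContDiffOn ℝ ∞ ρ W ∧ ∀ x ∈ W, ∃ m μ : ℝ,
      HasFDerivAt ρ (m • (minkL (lcross (p x) (u x))).comp (fderiv ℝ p x)) x ∧
      HasFDerivAt (fun x => Real.cosh (-T x) • p x + Real.sinh (-T x) • u x)
        ((m • (minkL (lcross (p x) (u x))).comp (fderiv ℝ p x)).smulRight (lcross (p x) (u x))) x ∧
      HasFDerivAt (fun x => Real.sinh (-T x) • p x + Real.cosh (-T x) • u x)
        ((μ • (minkL (lcross (p x) (u x))).comp (fderiv ℝ p x)).smulRight (lcross (p x) (u x))) x ∧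
      (T x = 0 → m = 1) := by
  set e : E → R3 := fun x => lcross (p x) (u x) with he
  set G : E → R3 := fun x => Real.cosh (-T x) • p x + Real.sinh (-T x) • u x with hG
  have hes : ContDiffOn ℝ ∞ e W := h.smooth.lcross h.smooth_field
  have hGs : ContDiffOn ℝ ∞ G W :=
    ((Real.contDiff_cosh.comp_contDiffOn hTs.neg).smul h.smooth).add
      ((Real.contDiff_sinh.comp_contDiffOn hTs.neg).smul h.smooth_field)
  have hder : ∀ x ∈ W, ∃ m μ : ℝ,
      HasFDerivAt G ((m • (minkL (e x)).comp (fderiv ℝ p x)).smulRight (e x)) x ∧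
      HasFDerivAt (fun x => Real.sinh (-T x) • p x + Real.cosh (-T x) • u x)
        ((μ • (minkL (e x)).comp (fderiv ℝ p x)).smulRight (e x)) x ∧ (T x = 0 → m = 1) := by
    intro x hx
    obtain ⟨k, hk⟩ := h.fderiv_field x hx
    have hp := h.hasFDerivAt hW hx
    have hu := h.hasFDerivAt_field hW hx
    have hC := (hT x hx).neg.cosh
    have hS := (hT x hx).neg.sinh
    have hDp : ∀ X, fderiv ℝ p x X = mink (u x) (fderiv ℝ p x X) • u x +
        mink (e x) (fderiv ℝ p x X) • e x := fun X => by
      have := (h.frame x hx).expand (fderiv ℝ p x X)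
      rw [mink_comm _ (p x), h.mink_fderiv hW hx, neg_zero, zero_smul, zero_add, mink_comm _ (u x),
        mink_comm _ (lcross _ _)] at this
      exact this
    refine ⟨Real.cosh (-T x) + Real.sinh (-T x) * k, Real.sinh (-T x) + Real.cosh (-T x) * k,
      ((hC.smul hp).add (hS.smul hu)).congr_fderiv ?_,
      ((hS.smul hp).add (hC.smul hu)).congr_fderiv ?_, fun h0 => by simp [h0]⟩
    · ext1 X
      have h1 := hDp X
      have h2 := hk X
      simp only [add_apply, smul_apply,
        ContinuousLinearMap.smulRight_apply, neg_apply,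
        ContinuousLinearMap.comp_apply, minkL_apply, smul_eq_mul, h2]
      rw [← he] at *
      generalize mink (u x) (fderiv ℝ p x X) = A at *
      generalize mink (e x) (fderiv ℝ p x X) = B at *
      rw [h1]
      module
    · ext1 X
      have h1 := hDp X
      have h2 := hk X
      simp only [add_apply, smul_apply,
        ContinuousLinearMap.smulRight_apply, neg_apply,
        ContinuousLinearMap.comp_apply, minkL_apply, smul_eq_mul, h2]
      generalize mink (u x) (fderiv ℝ p x X) = A at *
      generalize mink (e x) (fderiv ℝ p x X) = B at *
      rw [h1]
      module
  have hee : ∀ x ∈ W, mink (e x) (e x) = 1 := fun x hx => (h.frame x hx).ee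
  have hede : ∀ x ∈ W, ∀ X, mink (fderiv ℝ e x X) (e x) = 0 := by
    intro x hx X
    have h1 := ((hes.contDiffAt (hW.mem_nhds hx)).differentiableAt (by simp)).hasFDerivAt
    have h2 := (h1.mink h1).unique ((hasFDerivAt_const (1 : ℝ) x).congr_of_eventuallyEq
      (by filter_upwards [hW.mem_nhds hx] with y hy using hee y hy))
    have h3 := congrArg (fun L : E →L[ℝ] ℝ => L X) h2
    simp at h3
    rw [mink_comm]
    linarith
  obtain ⟨ρ, hρ0, hρs, hρ⟩ := exists_primitive hW hWc hes hGs (fun x hx X Y => by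
    obtain ⟨m, μ, h1, -⟩ := hder x hx
    simp [h1.fderiv, hede x hx]) x₀
  refine ⟨ρ, hρ0, hρs, fun x hx => ?_⟩
  obtain ⟨m, μ, h1, h2, h3⟩ := hder x hx
  refine ⟨m, μ, (hρ x hx).congr_fderiv ?_, h1, h2, h3⟩
  ext X
  simp only [h1.fderiv, ContinuousLinearMap.comp_apply, ContinuousLinearMap.smulRight_apply,
    minkL_apply, mink_smul_right, hee x hx, mul_one]
  rfl

end IsGeodesicField

/-- A function on a convex open set whose differential is a multiple of `ℓ` depends on `ℓ` only. -/
lemma eq_of_fderiv_smulRight {V : Type*} [NormedAddCommGroup V] [NormedSpace ℝ V] {B : Set V}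
    (hBc : Convex ℝ B) {F : V → R3} {ℓ : V →L[ℝ] ℝ}
    (hF : ∀ w ∈ B, ∃ y : R3, HasFDerivAt F (ℓ.smulRight y) w) {w w' : V} (hw : w ∈ B)
    (hw' : w' ∈ B) (h : ℓ w = ℓ w') : F w = F w' := by
  have hmem : ∀ τ ∈ Icc (0 : ℝ) 1, w + τ • (w' - w) ∈ B := fun τ hτ =>
    hBc.add_smul_sub_mem hw hw' hτ
  have hd : ∀ τ ∈ Icc (0 : ℝ) 1, HasDerivAt (fun τ : ℝ => F (w + τ • (w' - w))) 0 τ := by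
    intro τ hτ
    obtain ⟨y, hy⟩ := hF _ (hmem τ hτ)
    have h1 : HasDerivAt (fun τ : ℝ => w + τ • (w' - w)) (w' - w) τ := by
      simpa using ((hasDerivAt_id τ).smul_const (w' - w)).const_add w
    refine (hy.comp_hasDerivAt τ h1).congr_deriv ?_
    simp [h]
  have := constant_of_has_deriv_right_zero (f := fun τ : ℝ => F (w + τ • (w' - w))) (a := 0) (b := 1)
    (fun τ hτ => (hd τ hτ).continuousAt.continuousWithinAt)
    (fun τ hτ => (hd τ ⟨hτ.1, hτ.2.le⟩).hasDerivWithinAt) 1 (by simp)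
  simpa using this.symm

/-- In coordinates `w` of which the arc length `ρ` of the footpoint is one, `ρ = ℓ w`, the
footpoint runs through a curve of `ℍ²`, and `p` is obtained from it by following the normal
geodesics. -/
lemma IsGeodesicField.exists_curve {V : Type*} [NormedAddCommGroup V] [NormedSpace ℝ V]
    {W : Set E} {p u : E → R3} (h : IsGeodesicField W p u)
    {T ρ : E → ℝ} (hTs : ContDiffOn ℝ ∞ T W)
    (hρ : ∀ x ∈ W, ∃ m μ : ℝ,
      HasFDerivAt ρ (m • (minkL (lcross (p x) (u x))).comp (fderiv ℝ p x)) x ∧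
      HasFDerivAt (fun x => Real.cosh (-T x) • p x + Real.sinh (-T x) • u x)
        ((m • (minkL (lcross (p x) (u x))).comp (fderiv ℝ p x)).smulRight (lcross (p x) (u x))) x ∧
      HasFDerivAt (fun x => Real.sinh (-T x) • p x + Real.cosh (-T x) • u x)
        ((μ • (minkL (lcross (p x) (u x))).comp (fderiv ℝ p x)).smulRight (lcross (p x) (u x))) x)
    {ε : ℝ} {g : V → E} (hg : ContDiffOn ℝ ∞ g (Metric.ball 0 ε))
    (hgW : ∀ w ∈ Metric.ball (0 : V) ε, g w ∈ W) {ℓ : V →L[ℝ] ℝ} {ι : ℝ →L[ℝ] V}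
    (hℓι : ∀ r, ℓ (ι r) = r) (hι : ∀ r, ‖ι r‖ ≤ |r|) (hℓ : ∀ w, |ℓ w| ≤ ‖w‖)
    (hgρ : ∀ w ∈ Metric.ball (0 : V) ε, ρ (g w) = ℓ w) :
    ∃ γ n : ℝ → R3, IsFrenetCurve (Ioo (-ε) ε) γ n ∧ ∀ w ∈ Metric.ball (0 : V) ε,
      p (g w) = Real.cosh (T (g w)) • γ (ℓ w) + Real.sinh (T (g w)) • n (ℓ w) := by
  set G : V → R3 := fun w => Real.cosh (-T (g w)) • p (g w) + Real.sinh (-T (g w)) • u (g w)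
    with hG
  set H : V → R3 := fun w => Real.sinh (-T (g w)) • p (g w) + Real.cosh (-T (g w)) • u (g w)
    with hH
  have hps := h.smooth.comp hg hgW
  have hus := h.smooth_field.comp hg hgW
  have hTgs := (hTs.comp hg hgW).neg
  have hCs := Real.contDiff_cosh.comp_contDiffOn hTgs
  have hSs := Real.contDiff_sinh.comp_contDiffOn hTgs
  have hGs : ContDiffOn ℝ ∞ G (Metric.ball 0 ε) := (hCs.smul hps).add (hSs.smul hus)
  have hHs : ContDiffOn ℝ ∞ H (Metric.ball 0 ε) := (hSs.smul hps).add (hCs.smul hus)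
  have hder : ∀ w ∈ Metric.ball (0 : V) ε,
      HasFDerivAt G (ℓ.smulRight (lcross (p (g w)) (u (g w)))) w ∧
      ∃ y, HasFDerivAt H (ℓ.smulRight y) w := by
    intro w hw
    obtain ⟨m, μ, h1, h2, h3⟩ := hρ _ (hgW w hw)
    have hgd := ((hg.contDiffAt (Metric.isOpen_ball.mem_nhds hw)).differentiableAt
      (by simp)).hasFDerivAt
    have h4 : (m • (minkL (lcross (p (g w)) (u (g w)))).comp (fderiv ℝ p (g w))).comp
        (fderiv ℝ g w) = ℓ := by
      refine (h1.comp w hgd).unique (ℓ.hasFDerivAt.congr_of_eventuallyEq ?_)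
      filter_upwards [Metric.isOpen_ball.mem_nhds hw] with y hy using hgρ y hy
    have h5 : ∀ X, m * mink (lcross (p (g w)) (u (g w)))
        (fderiv ℝ p (g w) (fderiv ℝ g w X)) = ℓ X := fun X => by
      rw [← h4]; simp
    -- `ρ ∘ g = ℓ` is a submersion, so the footpoint moves with nonzero speed
    have hm : m ≠ 0 := by
      rintro rfl
      have := h5 (ι 1)
      rw [hℓι] at this
      simp at this
    refine ⟨(h2.comp w hgd).congr_fderiv ?_, (μ / m) • lcross (p (g w)) (u (g w)),
      (h3.comp w hgd).congr_fderiv ?_⟩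
    · ext1 X
      simp [← h5]
    · ext1 X
      simp [← h5, smul_smul]
      congr 1
      field_simp
  have hιB : ∀ r ∈ Ioo (-ε) ε, ι r ∈ Metric.ball (0 : V) ε := fun r hr => by
    rw [mem_ball_zero_iff]; exact (hι r).trans_lt (abs_lt.2 hr)
  have hGp : ∀ w ∈ Metric.ball (0 : V) ε, IsFrame (G w) (H w) ∧ 0 < G w 0 ∧
      lcross (G w) (H w) = lcross (p (g w)) (u (g w)) := fun w hw =>
    ⟨(h.frame _ (hgW w hw)).boost _, (h.frame _ (hgW w hw)).geodesic_pos (h.pos _ (hgW w hw)) _,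
      lcross_boost _ _ _⟩
  refine ⟨fun r => G (ι r), fun r => H (ι r), ⟨?_, ?_, ?_, ?_, ?_⟩, ?_⟩
  · exact hGs.comp ι.contDiff.contDiffOn hιB
  · exact hHs.comp ι.contDiff.contDiffOn hιB
  · exact fun r hr => (hGp _ (hιB r hr)).1
  · exact fun r hr => (hGp _ (hιB r hr)).2.1
  · intro r hr
    have h1 := (hder _ (hιB r hr)).1.comp_hasDerivAt r ι.hasDerivAt
    refine h1.congr_deriv ?_
    simp [hℓι, (hGp _ (hιB r hr)).2.2]
  · intro w hw
    have hw' : ι (ℓ w) ∈ Metric.ball (0 : V) ε := by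
      apply hιB
      rw [mem_ball_zero_iff] at hw
      exact abs_lt.1 ((hℓ w).trans_lt hw)
    have h1 : G (ι (ℓ w)) = G w := eq_of_fderiv_smulRight (convex_ball _ _)
      (fun y hy => ⟨_, (hder y hy).1⟩) hw' hw (hℓι _)
    have h2 : H (ι (ℓ w)) = H w := eq_of_fderiv_smulRight (convex_ball _ _)
      (fun y hy => (hder y hy).2) hw' hw (hℓι _)
    change p (g w) = Real.cosh (T (g w)) • G (ι (ℓ w)) + Real.sinh (T (g w)) • H (ι (ℓ w))
    rw [h1, h2]
    simp only [hG, hH, Real.cosh_neg, Real.sinh_neg]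
    have := Real.cosh_sq (T (g w))
    generalize Real.cosh (T (g w)) = C at *
    generalize Real.sinh (T (g w)) = S at *
    have h3 : C • (C • p (g w) + -S • u (g w)) + S • (-S • p (g w) + C • u (g w)) =
      (C ^ 2 - S ^ 2) • p (g w) := by module
    rw [h3, this]; simp

end LocalStructure

/-! ### Adapted coordinates -/

/-- The inverse function theorem in the form used here: on a ball around the image of `x₀` there is
a smooth local inverse, immersive, with values in a given neighbourhood. -/
lemma exists_local_inverse {E V : Type*} [NormedAddCommGroup E] [NormedSpace ℝ E]
    [CompleteSpace E] [NormedAddCommGroup V] [NormedSpace ℝ V] {W : Set E}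
    (hW : IsOpen W) {x₀ : E} (hx₀ : x₀ ∈ W) {ψ : E → V} (hψ : ContDiffOn ℝ ∞ ψ W)
    (h0 : ψ x₀ = 0) (A : E ≃L[ℝ] V) (hA : fderiv ℝ ψ x₀ = A) :
    ∃ (ε : ℝ) (g : V → E), 0 < ε ∧ ContDiffOn ℝ ∞ g (Metric.ball 0 ε) ∧
      (∀ w ∈ Metric.ball (0 : V) ε, g w ∈ W ∧ ψ (g w) = w) ∧
      (∀ w ∈ Metric.ball (0 : V) ε, Function.Injective (fderiv ℝ g w)) ∧
      ∀ δ, 0 < δ → g '' Metric.ball 0 δ ∈ 𝓝 x₀ := by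
  have hat : ∀ x ∈ W, ContDiffAt ℝ ∞ ψ x := fun x hx => hψ.contDiffAt (hW.mem_nhds hx)
  have hder : ∀ x ∈ W, HasFDerivAt ψ (fderiv ℝ ψ x) x := fun x hx =>
    ((hat x hx).differentiableAt (by simp)).hasFDerivAt
  let e := (hat x₀ hx₀).toOpenPartialHomeomorph ψ (f' := A) (hA ▸ hder x₀ hx₀) (by simp)
  have heψ : ∀ x, e x = ψ x := fun x => rfl
  have hsrc : x₀ ∈ e.source := (hat x₀ hx₀).mem_toOpenPartialHomeomorph_source _ _
  have htgt : (0 : V) ∈ e.target := by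
    have := e.map_source hsrc
    rwa [heψ, h0] at this
  have hsymm0 : e.symm 0 = x₀ := by
    rw [← h0, ← heψ]; exact e.left_inv hsrc
  have hcont : ContinuousAt e.symm 0 := e.continuousAt_symm htgt
  have hgood : ∀ᶠ x in 𝓝 x₀, x ∈ W ∧
      fderiv ℝ ψ x ∈ range ((↑) : (E ≃L[ℝ] V) → E →L[ℝ] V) := by
    have hc : ContinuousAt (fderiv ℝ ψ) x₀ :=
      ((hat x₀ hx₀).fderiv_right (m := ∞) (by simp)).continuousAt
    refine Filter.Eventually.and (hW.mem_nhds hx₀) ?_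
    refine hc.eventually_mem ?_
    rw [hA]; exact ContinuousLinearEquiv.nhds A
  have hgood' : ∀ᶠ w in 𝓝 (0 : V), w ∈ e.target ∧ e.symm w ∈ W ∧
      fderiv ℝ ψ (e.symm w) ∈ range ((↑) : (E ≃L[ℝ] V) → E →L[ℝ] V) := by
    refine Filter.Eventually.and (e.open_target.mem_nhds htgt) ?_
    rw [← hsymm0] at hgood
    exact hcont.eventually hgood
  obtain ⟨ε, hε, hball⟩ := Metric.eventually_nhds_iff_ball.1 hgood'
  have hsm : ∀ w ∈ Metric.ball (0 : V) ε, ContDiffAt ℝ ∞ e.symm w := by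
    intro w hw
    obtain ⟨h1, h2, B, hB⟩ := hball w hw
    exact e.contDiffAt_symm (f₀' := B) h1 (hB ▸ hder _ h2) (hat _ h2)
  have hinv : ∀ w ∈ Metric.ball (0 : V) ε, ψ (e.symm w) = w := fun w hw =>
    e.right_inv (hball w hw).1
  refine ⟨ε, e.symm, hε, fun w hw => (hsm w hw).contDiffWithinAt,
    fun w hw => ⟨(hball w hw).2.1, hinv w hw⟩, fun w hw => ?_, fun δ hδ => ?_⟩
  · have h1 := (hder _ (hball w hw).2.1).comp w
      ((hsm w hw).differentiableAt (by simp)).hasFDerivAt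
    have h2 : (fderiv ℝ ψ (e.symm w)).comp (fderiv ℝ e.symm w) = ContinuousLinearMap.id ℝ V := by
      refine h1.unique ((hasFDerivAt_id w).congr_of_eventuallyEq ?_)
      filter_upwards [Metric.isOpen_ball.mem_nhds hw] with y hy using hinv y hy
    exact Function.LeftInverse.injective (g := fderiv ℝ ψ (e.symm w))
      (fun X => congrArg (fun L : V →L[ℝ] V => L X) h2)
  · have h1 : ∀ᶠ x in 𝓝 x₀, ψ x ∈ Metric.ball (0 : V) δ := by
      refine (hat x₀ hx₀).continuousAt.eventually_mem ?_
      rw [h0]; exact Metric.ball_mem_nhds _ hδ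
    filter_upwards [h1, e.open_source.mem_nhds hsrc] with x hx hx'
    exact ⟨ψ x, hx, e.left_inv hx'⟩

section

variable {E : Type*} [NormedAddCommGroup E] [NormedSpace ℝ E]

/-- The local form of the classification: two geodesic fields whose potentials are proportional
give adapted coordinates `(t, r, s)`. -/
lemma exists_adapted_coordinates [FiniteDimensional ℝ E] (hE : Module.finrank ℝ E = 3)
    {W : Set E} (hW : IsOpen W) (hWc : Convex ℝ W) {x₀ : E} (hx₀ : x₀ ∈ W)
    {p u q v : E → R3} (h : IsGeodesicField W p u) (h' : IsGeodesicField W q v) {c : ℝ}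
    (hc0 : 0 < c) (hc1 : c < 1)
    (hrel : ∀ x ∈ W, ∀ X, √(1 - c) * mink (u x) (fderiv ℝ p x X) =
      √c * mink (v x) (fderiv ℝ q x X))
    (hinj : ∀ X, fderiv ℝ p x₀ X = 0 → fderiv ℝ q x₀ X = 0 → X = 0) :
    ∃ (ε : ℝ) (g : ℝ × ℝ × ℝ → E) (γ n γ' n' : ℝ → R3), 0 < ε ∧
      ContDiffOn ℝ ∞ g (Metric.ball 0 ε) ∧ (∀ w ∈ Metric.ball 0 ε, g w ∈ W) ∧
      (∀ w ∈ Metric.ball 0 ε, Function.Injective (fderiv ℝ g w)) ∧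
      (∀ δ, 0 < δ → g '' Metric.ball 0 δ ∈ 𝓝 x₀) ∧
      IsFrenetCurve (Ioo (-ε) ε) γ n ∧ IsFrenetCurve (Ioo (-ε) ε) γ' n' ∧
      ∀ w ∈ Metric.ball 0 ε, (p (g w), q (g w)) = curveMap c γ n γ' n' w := by
  have hcs : 0 < √c := Real.sqrt_pos.2 hc0
  have hcs' : 0 < √(1 - c) := Real.sqrt_pos.2 (by linarith)
  obtain ⟨T, hT0, hTs, hT⟩ := h.exists_potential hW hWc x₀
  let t : E → ℝ := fun x => (√c)⁻¹ * T x
  have hts : ContDiffOn ℝ ∞ t W := contDiffOn_const.mul hTs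
  -- the potential of `v` is proportional to that of `u`
  have hT' : ∀ x ∈ W, HasFDerivAt (fun x => √(1 - c) * t x)
      ((minkL (v x)).comp (fderiv ℝ q x)) x := by
    intro x hx
    refine (((hT x hx).const_mul (√c)⁻¹).const_mul √(1 - c)).congr_fderiv ?_
    ext X
    have := hrel x hx X
    simp only [smul_apply, ContinuousLinearMap.comp_apply, minkL_apply, smul_eq_mul]
    field_simp
    linarith
  have hT's : ContDiffOn ℝ ∞ (fun x => √(1 - c) * t x) W := contDiffOn_const.mul hts
  obtain ⟨ρ, hρ0, hρs, hρ⟩ := h.exists_arcLength_of_footpoint hW hWc x₀ hTs hT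
  obtain ⟨ρ', hρ0', hρs', hρ'⟩ := h'.exists_arcLength_of_footpoint hW hWc x₀ hT's hT'
  let ψ : E → ℝ × ℝ × ℝ := fun x => (t x, ρ x, ρ' x)
  have hψ : ContDiffOn ℝ ∞ ψ W := hts.prodMk (hρs.prodMk hρs')
  obtain ⟨m, μ, h1, -, -, hm⟩ := hρ x₀ hx₀
  obtain ⟨m', μ', h1', -, -, hm'⟩ := hρ' x₀ hx₀
  have hψd : HasFDerivAt ψ _ x₀ :=
    ((hT x₀ hx₀).const_mul (√c)⁻¹).prodMk (h1.prodMk h1')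
  rw [hm hT0, hm' (by simp [t, hT0])] at hψd
  have hψinj : Function.Injective (fderiv ℝ ψ x₀) := by
    rw [injective_iff_map_eq_zero]
    intro X hX
    rw [hψd.fderiv] at hX
    simp only [ContinuousLinearMap.prod_apply, Prod.mk_eq_zero, smul_apply, one_smul,
      ContinuousLinearMap.comp_apply, minkL_apply, smul_eq_mul, mul_eq_zero, inv_eq_zero,
      hcs.ne', false_or] at hX
    obtain ⟨ha, hb, hd⟩ := hX
    have hr := hrel x₀ hx₀ X
    rw [ha, mul_zero, zero_eq_mul] at hr
    have hr := hr.resolve_left hcs.ne'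
    refine hinj X ?_ ?_
    · rw [(h.frame x₀ hx₀).expand (fderiv ℝ p x₀ X), mink_comm _ (p x₀), h.mink_fderiv hW hx₀,
        mink_comm _ (u x₀), ha, mink_comm _ (lcross _ _), hb]
      simp
    · rw [(h'.frame x₀ hx₀).expand (fderiv ℝ q x₀ X), mink_comm _ (q x₀), h'.mink_fderiv hW hx₀,
        mink_comm _ (v x₀), hr, mink_comm _ (lcross _ _), hd]
      simp
  let A : E ≃L[ℝ] ℝ × ℝ × ℝ := (LinearEquiv.ofInjectiveOfFinrankEq
    (fderiv ℝ ψ x₀ : E →ₗ[ℝ] ℝ × ℝ × ℝ) hψinj (by simp [hE])).toContinuousLinearEquiv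
  have hA : fderiv ℝ ψ x₀ = A := by ext1 X; rfl
  obtain ⟨ε, g, hε, hgs, hgW, hgi, hgn⟩ := exists_local_inverse hW hx₀ hψ
    (by simp [ψ, t, hT0, hρ0, hρ0']) A hA
  let ℓ : ℝ × ℝ × ℝ →L[ℝ] ℝ := (ContinuousLinearMap.fst ℝ ℝ ℝ).comp (.snd ℝ ℝ (ℝ × ℝ))
  let ℓ' : ℝ × ℝ × ℝ →L[ℝ] ℝ := (ContinuousLinearMap.snd ℝ ℝ ℝ).comp (.snd ℝ ℝ (ℝ × ℝ))
  let ι : ℝ →L[ℝ] ℝ × ℝ × ℝ := (ContinuousLinearMap.inr ℝ ℝ (ℝ × ℝ)).comp (.inl ℝ ℝ ℝ)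
  let ι' : ℝ →L[ℝ] ℝ × ℝ × ℝ := (ContinuousLinearMap.inr ℝ ℝ (ℝ × ℝ)).comp (.inr ℝ ℝ ℝ)
  obtain ⟨γ, n, hγ, hp⟩ := h.exists_curve (ℓ := ℓ) (ι := ι) hTs
    (fun x hx => by obtain ⟨a, b, h1, h2, h3, -⟩ := hρ x hx; exact ⟨a, b, h1, h2, h3⟩)
    hgs (fun w hw => (hgW w hw).1) (fun r => by simp [ℓ, ι]) (fun r => by simp [ι, Prod.norm_def])
    (fun w => (norm_fst_le w.2).trans (norm_snd_le w))
    (fun w hw => congrArg (fun z : ℝ × ℝ × ℝ => z.2.1) (hgW w hw).2)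
  obtain ⟨γ', n', hγ', hq⟩ := h'.exists_curve (ℓ := ℓ') (ι := ι') hT's
    (fun x hx => by obtain ⟨a, b, h1, h2, h3, -⟩ := hρ' x hx; exact ⟨a, b, h1, h2, h3⟩)
    hgs (fun w hw => (hgW w hw).1) (fun r => by simp [ℓ', ι'])
    (fun r => by simp [ι', Prod.norm_def])
    (fun w => (norm_snd_le w.2).trans (norm_snd_le w))
    (fun w hw => congrArg (fun z : ℝ × ℝ × ℝ => z.2.2) (hgW w hw).2)
  refine ⟨ε, g, γ, n, γ', n', hε, hgs, fun w hw => (hgW w hw).1, hgi, hgn, hγ, hγ', ?_⟩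
  intro w hw
  have htw : t (g w) = w.1 := congrArg (fun z : ℝ × ℝ × ℝ => z.1) (hgW w hw).2
  have hTw : T (g w) = √c * w.1 := by
    rw [← htw]; simp only [t]; field_simp
  rw [hp w hw, hq w hw, hTw, htw]
  rfl

/-- The pointwise content of the principal direction hypothesis: if `J u` is a principal direction
then so is `J v`, and the shape operator is diagonal in the basis adapted to the product. -/
lemma weingarten_of_principal [FiniteDimensional ℝ E] (hE : Module.finrank ℝ E = 3)
    {p u q v : R3} {Dp Du Dq Dv : E →L[ℝ] R3} (hf : IsFrame p u) (hf' : IsFrame q v)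
    (hp : ∀ X, mink p (Dp X) = 0) (hq : ∀ X, mink q (Dq X) = 0)
    (hu : ∀ X, mink u (Du X) = 0) (hv : ∀ X, mink v (Dv X) = 0)
    (hpu : ∀ X, mink p (Du X) = -mink u (Dp X)) (hqv : ∀ X, mink q (Dv X) = -mink v (Dq X))
    {a b : ℝ} (ha : 0 < a) (hb : 0 < b) (hrel : ∀ X, a * mink u (Dp X) = b * mink v (Dq X))
    (hinj : ∀ X, Dp X = 0 → Dq X = 0 → X = 0)
    (hsymm : ∀ X Y, a * (mink (Du X) (Dp Y) - mink (Du Y) (Dp X)) =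
      b * (mink (Dv X) (Dq Y) - mink (Dv Y) (Dq X)))
    {X₁ : E} {l : ℝ} (hX₁ : Dp X₁ = lcross p u) (hX₁' : Dq X₁ = 0)
    (hDu : Du X₁ + mink (Du X₁) p • p = l • lcross p u)
    (hDv : Dv X₁ + mink (Dv X₁) q • q = 0) :
    (∃ k : ℝ, ∀ X, Du X = mink u (Dp X) • p + (k * mink (lcross p u) (Dp X)) • lcross p u) ∧
    ∃ k : ℝ, ∀ X, Dv X = mink v (Dq X) • q + (k * mink (lcross q v) (Dq X)) • lcross q v := by
  have hDu1 : Du X₁ = l • lcross p u := by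
    have h1 : mink (Du X₁) p = 0 := by rw [mink_comm, hpu, hX₁, mink_comm]; simp
    rwa [h1, zero_smul, add_zero] at hDu
  have hDv1 : Dv X₁ = 0 := by
    have h1 : mink (Dv X₁) q = 0 := by rw [mink_comm, hqv, hX₁']; simp
    rwa [h1, zero_smul, add_zero] at hDv
  have hk : ∀ X, mink (Du X) (lcross p u) = l * mink (lcross p u) (Dp X) := by
    intro X
    have h1 := hsymm X₁ X
    rw [hDu1, hDv1, hX₁, hX₁'] at h1
    simp only [mink_smul_left, mink_zero_left, mink_zero_right, sub_zero, mul_zero,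
      mul_eq_zero, ha.ne', false_or] at h1
    linarith
  -- the three forms below determine a tangent vector, so one can prescribe their values
  let Λ : E →L[ℝ] ℝ × ℝ × ℝ := ((minkL u).comp Dp).prod
    (((minkL (lcross p u)).comp Dp).prod ((minkL (lcross q v)).comp Dq))
  have hΛ : Function.Injective Λ := by
    rw [injective_iff_map_eq_zero]
    intro X hX
    simp only [Λ, ContinuousLinearMap.prod_apply, Prod.mk_eq_zero, ContinuousLinearMap.comp_apply,
      minkL_apply] at hX
    obtain ⟨h1, h2, h3⟩ := hX
    have h4 := hrel X
    rw [h1, mul_zero, zero_eq_mul] at h4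
    have h4 := h4.resolve_left hb.ne'
    refine hinj X ?_ ?_
    · rw [hf.expand (Dp X), mink_comm _ p, hp, mink_comm _ u, h1, mink_comm _ (lcross _ _), h2]
      simp
    · rw [hf'.expand (Dq X), mink_comm _ q, hq, mink_comm _ v, h4, mink_comm _ (lcross _ _), h3]
      simp
  obtain ⟨X₂, hX₂⟩ := (LinearMap.injective_iff_surjective_of_finrank_eq_finrank
    (f := (Λ : E →ₗ[ℝ] ℝ × ℝ × ℝ)) (by simp [hE])).1 hΛ (0, 0, 1)
  simp only [Λ, ContinuousLinearMap.coe_coe, ContinuousLinearMap.prod_apply, Prod.mk.injEq,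
    ContinuousLinearMap.comp_apply, minkL_apply] at hX₂
  obtain ⟨h1, h2, h3⟩ := hX₂
  have h4 := hrel X₂
  rw [h1, mul_zero, zero_eq_mul] at h4
  have h4 := h4.resolve_left hb.ne'
  have hDp2 : Dp X₂ = 0 := by
    rw [hf.expand (Dp X₂), mink_comm _ p, hp, mink_comm _ u, h1, mink_comm _ (lcross _ _), h2]
    simp
  have hDq2 : Dq X₂ = lcross q v := by
    rw [hf'.expand (Dq X₂), mink_comm _ q, hq, mink_comm _ v, h4, mink_comm _ (lcross _ _), h3]
    simp
  have hDu2 : Du X₂ = 0 := by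
    rw [hf.expand (Du X₂), mink_comm _ p, hpu, mink_comm _ u, hu, hk, hDp2]
    simp
  have hDv2 : Dv X₂ = mink (Dv X₂) (lcross q v) • lcross q v := by
    have := hf'.expand (Dv X₂)
    rwa [mink_comm _ q, hqv, mink_comm _ v, hv, h4, neg_zero, neg_zero, zero_smul, zero_smul,
      zero_add, zero_add] at this
  have hk' : ∀ X, mink (Dv X) (lcross q v) =
      mink (Dv X₂) (lcross q v) * mink (lcross q v) (Dq X) := by
    intro X
    have h5 := hsymm X₂ X
    rw [hDu2, hDp2, hDq2] at h5
    simp only [mink_zero_left, mink_zero_right, sub_zero, mul_zero, zero_eq_mul, hb.ne',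
      false_or] at h5
    have h6 := congrArg (fun z => mink z (Dq X)) hDv2
    simp only [mink_smul_left] at h6
    linarith
  refine ⟨⟨l, fun X => ?_⟩, mink (Dv X₂) (lcross q v), fun X => ?_⟩
  · have h5 := hf.expand (Du X)
    rwa [mink_comm _ p, hpu, mink_comm _ u, hu, hk, neg_neg, zero_smul, add_zero] at h5
  · have h5 := hf'.expand (Dv X)
    rwa [mink_comm _ q, hqv, mink_comm _ v, hv, hk', neg_neg, zero_smul, add_zero] at h5

end

/-! ### Hypersurfaces in a chart -/

section Manifold

variable {M : Type*} [TopologicalSpace M] [ChartedSpace (EuclideanSpace ℝ (Fin 3)) M]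

/-- The chain rule for a parametrization `φ` of a part of `M`. -/
lemma fderiv_comp_param {E : Type*} [NormedAddCommGroup E] [NormedSpace ℝ E] {h : M → R6}
    (hh : ContMDiff (𝓡 3) 𝓘(ℝ, R6) ∞ h) {φ : E → M} {y : E}
    (hφ : MDifferentiableAt 𝓘(ℝ, E) (𝓡 3) φ y) (X : E) :
    fderiv ℝ (fun z => h (φ z)) y X = diff h (φ y) (mfderiv 𝓘(ℝ, E) (𝓡 3) φ y X) := by
  have h1 := mfderiv_comp y ((hh (φ y)).mdifferentiableAt (by simp)) hφ
  have h2 : mfderiv 𝓘(ℝ, E) 𝓘(ℝ, R6) (h ∘ φ) y = fderiv ℝ (h ∘ φ) y := mfderiv_eq_fderiv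
  rw [h2] at h1
  exact congrArg (fun L : E →L[ℝ] R6 => L X) h1

/-- A smooth parametrization of a neighbourhood of a point of `M`. -/
lemma exists_param [IsManifold (𝓡 3) ∞ M] (x : M) :
    ∃ (φ : EuclideanSpace ℝ (Fin 3) → M) (O : Set (EuclideanSpace ℝ (Fin 3)))
      (y₀ : EuclideanSpace ℝ (Fin 3)), IsOpen O ∧ y₀ ∈ O ∧
      ContMDiffOn 𝓘(ℝ, EuclideanSpace ℝ (Fin 3)) (𝓡 3) ∞ φ O ∧
      (∀ y ∈ O, Function.Bijective (mfderiv 𝓘(ℝ, EuclideanSpace ℝ (Fin 3)) (𝓡 3) φ y)) ∧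
      ∀ S ∈ 𝓝 y₀, φ '' S ∈ 𝓝 x := by
  have : IsManifold (𝓡 3) 1 M := IsManifold.of_le (n := ∞) (by exact_mod_cast le_top)
  refine ⟨(extChartAt (𝓡 3) x).symm, (extChartAt (𝓡 3) x).target, extChartAt (𝓡 3) x x,
    isOpen_extChartAt_target x, mem_extChartAt_target x, contMDiffOn_extChartAt_symm x,
    fun y hy => ?_, fun S hS => ?_⟩
  · have h1 := isInvertible_mfderivWithin_extChartAt_symm hy
    rw [ModelWithCorners.range_eq_univ, mfderivWithin_univ] at h1
    obtain ⟨A, hA⟩ := h1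
    have h2 := A.bijective
    rw [← ContinuousLinearEquiv.coe_coe, hA] at h2
    exact h2
  · have h1 : ∀ᶠ z in 𝓝 x, extChartAt (𝓡 3) x z ∈ S :=
      (continuousAt_extChartAt (I := 𝓡 3) x).eventually_mem hS
    filter_upwards [h1, extChartAt_source_mem_nhds (I := 𝓡 3) x] with z hz hz'
    exact ⟨_, hz, (extChartAt (𝓡 3) x).left_inv hz'⟩

/-- The symmetry of the shape operator, in terms of the two components of the immersion and of the
normal field. -/
lemma weingarten_symm {E : Type*} [NormedAddCommGroup E] [NormedSpace ℝ E] {p u q v : E → R3}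
    {O : Set E} (hO : IsOpen O) (hp : ContDiffOn ℝ ∞ p O) (hu : ContDiffOn ℝ ∞ u O)
    (hq : ContDiffOn ℝ ∞ q O) (hv : ContDiffOn ℝ ∞ v O) {a b : ℝ}
    (hrel : ∀ y ∈ O, ∀ X, a * mink (u y) (fderiv ℝ p y X) = b * mink (v y) (fderiv ℝ q y X))
    {y : E} (hy : y ∈ O) (X Y : E) :
    a * (mink (fderiv ℝ u y X) (fderiv ℝ p y Y) - mink (fderiv ℝ u y Y) (fderiv ℝ p y X)) =
      b * (mink (fderiv ℝ v y X) (fderiv ℝ q y Y) - mink (fderiv ℝ v y Y) (fderiv ℝ q y X)) := by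
  have hn := hO.mem_nhds hy
  obtain ⟨D, hD, hD'⟩ := hasFDerivAt_minkL_comp_fderiv (hu.contDiffAt hn) (hp.contDiffAt hn)
  obtain ⟨D₂, hD₂, hD₂'⟩ := hasFDerivAt_minkL_comp_fderiv (hv.contDiffAt hn) (hq.contDiffAt hn)
  have h1 : a • D = b • D₂ := by
    refine (hD.const_smul a).unique ((hD₂.const_smul b).congr_of_eventuallyEq ?_)
    filter_upwards [hn] with z hz
    ext Z
    simpa using hrel z hz Z
  have h2 : ∀ X Y, a * D X Y = b * D₂ X Y := fun X Y =>
    congrArg (fun L : E →L[ℝ] E →L[ℝ] ℝ => L X Y) h1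
  have h3 := h2 X Y
  have h4 := h2 Y X
  rw [hD', hD₂', fderiv_fderiv_symm (hp.contDiffAt hn), fderiv_fderiv_symm (hq.contDiffAt hn)] at h3
  rw [hD', hD₂'] at h4
  linear_combination h3 - h4

/-- Around each of its points, a hypersurface with constant product angle for which `J₁ N + J₂ N` is
principal is parametrized by a map `curveMap c γ n γ' n'`. -/
lemma exists_local_curveMap [IsManifold (𝓡 3) ∞ M] {f N : M → R6}
    (hf : IsOrientedHypersurface f N) {C : ℝ} (hC : |C| < 1) (hconst : ∀ x, productAngle N x = C)
    (hprin : IsPrincipalField f N (fun x => J1 (f x) (N x) + J2 (f x) (N x))) (x : M) :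
    ∃ (ε : ℝ) (g : ℝ × ℝ × ℝ → M) (γ n γ' n' : ℝ → R3), 0 < ε ∧
      ContMDiffOn 𝓘(ℝ, ℝ × ℝ × ℝ) (𝓡 3) ∞ g (Metric.ball 0 ε) ∧
      (∀ δ, 0 < δ → g '' Metric.ball 0 δ ∈ 𝓝 x) ∧
      IsFrenetCurve (Ioo (-ε) ε) γ n ∧ IsFrenetCurve (Ioo (-ε) ε) γ' n' ∧
      ∀ w ∈ Metric.ball 0 ε, f (g w) = curveMap ((1 - C) / 2) γ n γ' n' w ∧
        Function.Injective (fderiv ℝ (curveMap ((1 - C) / 2) γ n γ' n') w) := by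
  obtain ⟨φ, O, y₀, hO, hy₀, hφ, hbij, himg⟩ := exists_param x
  rw [abs_lt] at hC
  set c := (1 - C) / 2 with hc
  have hc0 : 0 < c := by rw [hc]; linarith
  have hc1 : c < 1 := by rw [hc]; linarith
  set a := √(1 - c) with ha_def
  set b := √c with hb_def
  have ha : 0 < a := Real.sqrt_pos.2 (by linarith)
  have hb : 0 < b := Real.sqrt_pos.2 hc0
  have ha2 : a ^ 2 = 1 - c := Real.sq_sqrt (by linarith)
  have hb2 : b ^ 2 = c := Real.sq_sqrt hc0.le
  have hφd : ∀ y ∈ O, MDifferentiableAt 𝓘(ℝ, EuclideanSpace ℝ (Fin 3)) (𝓡 3) φ y := fun y hy =>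
    (hφ.contMDiffAt (hO.mem_nhds hy)).mdifferentiableAt (by simp)
  set F : EuclideanSpace ℝ (Fin 3) → R6 := fun y => f (φ y) with hF
  set K : EuclideanSpace ℝ (Fin 3) → R6 := fun y => N (φ y) with hK
  have hFs : ContDiffOn ℝ ∞ F O := (hf.smooth.comp_contMDiffOn hφ).contDiffOn
  have hKs : ContDiffOn ℝ ∞ K O := (hf.smooth_normal.comp_contMDiffOn hφ).contDiffOn
  have hFd : ∀ y ∈ O, ∀ X, fderiv ℝ F y X = diff f (φ y) (mfderiv 𝓘(ℝ, _) (𝓡 3) φ y X) :=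
    fun y hy X => fderiv_comp_param hf.smooth (hφd y hy) X
  have hKd : ∀ y ∈ O, ∀ X, fderiv ℝ K y X = diff N (φ y) (mfderiv 𝓘(ℝ, _) (𝓡 3) φ y X) :=
    fun y hy X => fderiv_comp_param hf.smooth_normal (hφd y hy) X
  have hFi : ∀ y ∈ O, Function.Injective (fderiv ℝ F y) := by
    intro y hy X Y hXY
    rw [hFd y hy, hFd y hy] at hXY
    exact (hbij y hy).1 (hf.immersion _ hXY)
  set p : EuclideanSpace ℝ (Fin 3) → R3 := fun y => (F y).1 with hp
  set q : EuclideanSpace ℝ (Fin 3) → R3 := fun y => (F y).2 with hq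
  set u : EuclideanSpace ℝ (Fin 3) → R3 := fun y => a⁻¹ • (K y).1 with hu
  set v : EuclideanSpace ℝ (Fin 3) → R3 := fun y => -b⁻¹ • (K y).2 with hv
  have hps : ContDiffOn ℝ ∞ p O := contDiff_fst.comp_contDiffOn hFs
  have hqs : ContDiffOn ℝ ∞ q O := contDiff_snd.comp_contDiffOn hFs
  have hus : ContDiffOn ℝ ∞ u O := (contDiff_fst.comp_contDiffOn hKs).const_smul a⁻¹
  have hvs : ContDiffOn ℝ ∞ v O := (contDiff_snd.comp_contDiffOn hKs).const_smul (-b⁻¹)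
  have hK1 : ∀ y, (K y).1 = a • u y := fun y => by rw [hu]; simp [smul_smul, ha.ne']
  have hK2 : ∀ y, (K y).2 = -b • v y := fun y => by rw [hv]; simp [smul_smul, hb.ne']
  have hFdiff : ∀ y ∈ O, HasFDerivAt F (fderiv ℝ F y) y := fun y hy =>
    ((hFs.contDiffAt (hO.mem_nhds hy)).differentiableAt (by simp)).hasFDerivAt
  have hKdiff : ∀ y ∈ O, HasFDerivAt K (fderiv ℝ K y) y := fun y hy =>
    ((hKs.contDiffAt (hO.mem_nhds hy)).differentiableAt (by simp)).hasFDerivAt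
  have hpd : ∀ y ∈ O, ∀ X, fderiv ℝ p y X = (fderiv ℝ F y X).1 := fun y hy X => by
    rw [(hFdiff y hy).fst.fderiv]; rfl
  have hqd : ∀ y ∈ O, ∀ X, fderiv ℝ q y X = (fderiv ℝ F y X).2 := fun y hy X => by
    rw [(hFdiff y hy).snd.fderiv]; rfl
  have hud : ∀ y ∈ O, ∀ X, (fderiv ℝ K y X).1 = a • fderiv ℝ u y X := fun y hy X => by
    have h1 : HasFDerivAt u _ y := (hKdiff y hy).fst.const_smul a⁻¹
    rw [h1.fderiv]
    simp [smul_smul, ha.ne']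
  have hvd : ∀ y ∈ O, ∀ X, (fderiv ℝ K y X).2 = -b • fderiv ℝ v y X := fun y hy X => by
    have h1 : HasFDerivAt v _ y := (hKdiff y hy).snd.const_smul (-b⁻¹)
    rw [h1.fderiv]
    simp [smul_smul, hb.ne']
  have hKK : ∀ y, mink (K y).1 (K y).1 = a ^ 2 ∧ mink (K y).2 (K y).2 = b ^ 2 := by
    intro y
    have h1 := hf.normal_unit (φ y)
    have h2 := hconst (φ y)
    simp only [productAngle, mink2, P, mink_neg_left] at h1 h2
    rw [ha2, hb2, hc]
    exact ⟨by linarith, by linarith⟩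
  have hframe : ∀ y, IsFrame (p y) (u y) := fun y => by
    refine ⟨(hf.mem (φ y)).1.1, ?_, ?_⟩
    · simp only [hu, mink_smul_left, mink_smul_right, (hKK y).1]
      field_simp
    · simp only [hu, mink_smul_right]
      rw [mink_comm, (hf.normal_tangent (φ y)).1, mul_zero]
  have hframe' : ∀ y, IsFrame (q y) (v y) := fun y => by
    refine ⟨(hf.mem (φ y)).2.1, ?_, ?_⟩
    · simp only [hv, mink_smul_left, mink_smul_right, (hKK y).2]
      field_simp
    · simp only [hv, mink_smul_right]
      rw [mink_comm, (hf.normal_tangent (φ y)).2, mul_zero]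
  have hrel : ∀ y ∈ O, ∀ X,
      a * mink (u y) (fderiv ℝ p y X) = b * mink (v y) (fderiv ℝ q y X) := by
    intro y hy X
    have h1 := hf.normal_orthogonal (φ y) (mfderiv 𝓘(ℝ, _) (𝓡 3) φ y X)
    rw [← hFd y hy] at h1
    change mink (fderiv ℝ F y X).1 (K y).1 + mink (fderiv ℝ F y X).2 (K y).2 = 0 at h1
    rw [hK1, hK2, ← hpd y hy, ← hqd y hy, mink_smul_right a _ (u y),
      mink_smul_right (-b) _ (v y), mink_comm _ (u y),
      mink_comm _ (v y)] at h1
    linarith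
  have hinj : ∀ y ∈ O, ∀ X, fderiv ℝ p y X = 0 → fderiv ℝ q y X = 0 → X = 0 := by
    intro y hy X h1 h2
    rw [hpd y hy] at h1
    rw [hqd y hy] at h2
    exact (injective_iff_map_eq_zero _).1 (hFi y hy) X (Prod.ext h1 h2)
  have hderiv : ∀ y ∈ O,
      (∃ k : ℝ, ∀ X, fderiv ℝ u y X = mink (u y) (fderiv ℝ p y X) • p y +
        (k * mink (lcross (p y) (u y)) (fderiv ℝ p y X)) • lcross (p y) (u y)) ∧
      ∃ k : ℝ, ∀ X, fderiv ℝ v y X = mink (v y) (fderiv ℝ q y X) • q y +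
        (k * mink (lcross (q y) (v y)) (fderiv ℝ q y X)) • lcross (q y) (v y) := by
    intro y hy
    have hn := hO.mem_nhds hy
    have hpD := ((hps.contDiffAt hn).differentiableAt (by simp)).hasFDerivAt
    have hqD := ((hqs.contDiffAt hn).differentiableAt (by simp)).hasFDerivAt
    have huD := ((hus.contDiffAt hn).differentiableAt (by simp)).hasFDerivAt
    have hvD := ((hvs.contDiffAt hn).differentiableAt (by simp)).hasFDerivAt
    -- the derivatives of the constant products of the frame vectors
    have hunit : ∀ {z : EuclideanSpace ℝ (Fin 3) → R3} {z' : EuclideanSpace ℝ (Fin 3) →L[ℝ] R3},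
        (∀ y, mink (z y) (z y) = 1) → HasFDerivAt z z' y → ∀ X, mink (z y) (z' X) = 0 := by
      intro z z' h hz X
      have h1 := congrArg (fun L : EuclideanSpace ℝ (Fin 3) →L[ℝ] ℝ => L X) ((hz.mink hz).unique
        ((hasFDerivAt_const (1 : ℝ) y).congr_of_eventuallyEq (Eventually.of_forall h)))
      simp at h1
      linarith
    have horth : ∀ {o z : EuclideanSpace ℝ (Fin 3) → R3}
        {o' z' : EuclideanSpace ℝ (Fin 3) →L[ℝ] R3},
        (∀ y, mink (o y) (z y) = 0) → HasFDerivAt o o' y → HasFDerivAt z z' y →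
        ∀ X, mink (o y) (z' X) = -mink (z y) (o' X) := by
      intro o z o' z' h ho hz X
      have h1 := congrArg (fun L : EuclideanSpace ℝ (Fin 3) →L[ℝ] ℝ => L X) ((ho.mink hz).unique
        ((hasFDerivAt_const (0 : ℝ) y).congr_of_eventuallyEq (Eventually.of_forall h)))
      simp at h1
      linarith
    obtain ⟨X', -, hX', l, hl⟩ := hprin (φ y)
    obtain ⟨X, rfl⟩ : ∃ X : EuclideanSpace ℝ (Fin 3), mfderiv 𝓘(ℝ, _) (𝓡 3) φ y X = X' :=
      (hbij y hy).2 X'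
    replace hX' : fderiv ℝ F y X = J1 (F y) (K y) + J2 (F y) (K y) := (hFd y hy X).trans hX'
    replace hl : tangentProj (F y) (fderiv ℝ K y X) = -(l • fderiv ℝ F y X) := by
      rw [hKd y hy, hFd y hy, ← map_smul]
      exact hl
    have hX1 : (fderiv ℝ F y X).1 = (2 * a) • lcross (p y) (u y) := by
      rw [hX']
      change lcross (p y) (K y).1 + lcross (p y) (K y).1 = _
      rw [hK1, lcross_smul_right]; module
    have hX2 : (fderiv ℝ F y X).2 = 0 := by
      rw [hX']
      exact add_neg_cancel _
    have hl1 := congrArg Prod.fst hl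
    have hl2 := congrArg Prod.snd hl
    simp only [tangentProj, Prod.fst_neg, Prod.smul_fst, Prod.snd_neg, Prod.smul_snd, hX1, hX2,
      hud y hy, hvd y hy, mink_smul_left] at hl1 hl2
    change a • fderiv ℝ u y X + (a * mink (fderiv ℝ u y X) (p y)) • p y = _ at hl1
    change -b • fderiv ℝ v y X + (-b * mink (fderiv ℝ v y X) (q y)) • q y = _ at hl2
    refine weingarten_of_principal (by simp) (hframe y) (hframe' y)
      (mink_fderiv_eq_zero (Eventually.of_forall fun z => (hframe z).pp) hpD)
      (mink_fderiv_eq_zero (Eventually.of_forall fun z => (hframe' z).pp) hqD)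
      (hunit (fun z => (hframe z).uu) huD) (hunit (fun z => (hframe' z).uu) hvD)
      (horth (fun z => (hframe z).pu) hpD huD) (horth (fun z => (hframe' z).pu) hqD hvD)
      ha hb (hrel y hy) (hinj y hy)
      (weingarten_symm hO hps hus hqs hvs hrel hy) (X₁ := (2 * a)⁻¹ • X) (l := -(l / a)) ?_ ?_ ?_ ?_
    · rw [map_smul, hpd y hy, hX1, inv_smul_smul₀ (by positivity)]
    · rw [map_smul, hqd y hy, hX2, smul_zero]
    · have h1 := congrArg (fun z => ((2 * a)⁻¹ * a⁻¹) • z) hl1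
      simp only [map_smul, mink_smul_left]
      convert h1 using 1
      · match_scalars <;> field_simp
      · match_scalars; field_simp
    · have h1 := congrArg (fun z => ((2 * a)⁻¹ * -b⁻¹) • z) hl2
      simp only [map_smul, mink_smul_left]
      convert h1 using 1
      · match_scalars <;> field_simp
      · simp
  have hgeo : IsGeodesicField O p u :=
    ⟨hps, hus, fun y _ => hframe y, fun y _ => (hf.mem (φ y)).1.2, fun y hy => (hderiv y hy).1⟩
  have hgeo' : IsGeodesicField O q v :=
    ⟨hqs, hvs, fun y _ => hframe' y, fun y _ => (hf.mem (φ y)).2.2, fun y hy => (hderiv y hy).2⟩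
  obtain ⟨R, hR, hRO⟩ := Metric.isOpen_iff.1 hO y₀ hy₀
  obtain ⟨ε, g, γ, n, γ', n', hε, hgs, hgW, hgi, hgn, hγ, hγ', hmap⟩ :=
    exists_adapted_coordinates (by simp) Metric.isOpen_ball (convex_ball y₀ R)
      (Metric.mem_ball_self hR) (hgeo.mono hRO) (hgeo'.mono hRO) hc0 hc1
      (fun y hy => hrel y (hRO hy)) (hinj y₀ hy₀)
  refine ⟨ε, fun w => φ (g w), γ, n, γ', n', hε,
    hφ.comp (contMDiffOn_iff_contDiffOn.2 hgs) (fun w hw => hRO (hgW w hw)), ?_, hγ, hγ', ?_⟩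
  · intro δ hδ
    have := himg _ (hgn δ hδ)
    rwa [image_image] at this
  · intro w hw
    refine ⟨hmap w hw, ?_⟩
    have h1 : curveMap c γ n γ' n' =ᶠ[𝓝 w] fun w => F (g w) := by
      filter_upwards [Metric.isOpen_ball.mem_nhds hw] with z hz using (hmap z hz).symm
    have h2 : HasFDerivAt (fun w => F (g w)) ((fderiv ℝ F (g w)).comp (fderiv ℝ g w)) w :=
      (hFdiff _ (hRO (hgW w hw))).comp w ((hgs.contDiffAt
        (Metric.isOpen_ball.mem_nhds hw)).differentiableAt (by simp)).hasFDerivAt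
    rw [h1.fderiv_eq, h2.fderiv, ContinuousLinearMap.coe_comp]
    exact (hFi _ (hRO (hgW w hw))).comp (hgi w hw)

end Manifold

/-! ### The classification -/

section Manifold

variable {M : Type*} [TopologicalSpace M] [ChartedSpace (EuclideanSpace ℝ (Fin 3)) M]

/-- If `J₁ N + J₂ N` is principal, countably many of the local parametrizations cover `M`; their
curves are strung along a single pair of curves, so that they become restrictions of a single map
`curveMap c γ n γ' n'`. -/
lemma exists_curves_of_principal [Nonempty M] [SecondCountableTopology M]
    [IsManifold (𝓡 3) ∞ M] {f N : M → R6}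
    (hf : IsOrientedHypersurface f N) {C : ℝ} (hC : |C| < 1) (hconst : ∀ x, productAngle N x = C)
    (hprin : IsPrincipalField f N (fun x => J1 (f x) (N x) + J2 (f x) (N x))) :
    ∃ (I I' : Set ℝ) (γ n γ' n' : ℝ → R3) (κ κ' : ℝ → ℝ),
      IsCurveWithNormal I γ n κ ∧ IsCurveWithNormal I' γ' n' κ' ∧
      IsOpenPart f I I' (curveMap ((1 - C) / 2) γ n γ' n') := by
  choose ε g γ n γ' n' hε hgs hgn hγ hγ' hmap using exists_local_curveMap hf hC hconst hprin
  obtain ⟨s, hs, hsU⟩ := TopologicalSpace.countable_cover_nhds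
    (f := fun x => g x '' Metric.ball 0 (ε x / 4)) (fun x => hgn x _ (by linarith [hε x]))
  have hsne : s.Nonempty := by
    by_contra hc
    rw [not_nonempty_iff_eq_empty.1 hc, biUnion_empty] at hsU
    exact empty_ne_univ hsU
  obtain ⟨e, he⟩ := hs.exists_eq_range hsne
  obtain ⟨I, Γ, ν, a, hIo, hIc, hΓ, hΓγ, hdisj⟩ := exists_isFrenetCurve_through
    (fun i => γ (e i)) (fun i => n (e i)) (fun i => ε (e i)) (fun i => hε _) (fun i => hγ _)
  obtain ⟨I', Γ', ν', a', hIo', hIc', hΓ', hΓγ', -⟩ := exists_isFrenetCurve_through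
    (fun i => γ' (e i)) (fun i => n' (e i)) (fun i => ε (e i)) (fun i => hε _) (fun i => hγ' _)
  refine ⟨I, I', Γ, ν, Γ', ν', _, _, hΓ.isCurveWithNormal hIo hIc,
    hΓ'.isCurveWithNormal hIo' hIc', ?_⟩
  -- the slots of the parameter domain, one for each local parametrization; they are disjoint because
  -- their projections to the parameter of the first curve are
  let A : ℕ → ℝ × ℝ × ℝ := fun i => (0, a i, a' i)
  let B : ℕ → Set (ℝ × ℝ × ℝ) := fun i => {w | w - A i ∈ Metric.ball 0 (ε (e i) / 4)}
  have hBo : ∀ i, IsOpen (B i) := fun i => Metric.isOpen_ball.preimage (by fun_prop)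
  have hB : ∀ i, ∀ w ∈ B i, |w.2.1 - a i| < ε (e i) / 4 ∧ |w.2.2 - a' i| < ε (e i) / 4 := by
    intro i w hw
    have h1 : ‖w - A i‖ < ε (e i) / 4 := mem_ball_zero_iff.1 hw
    have h2 := (norm_snd_le (w - A i)).trans_lt h1
    exact ⟨(norm_fst_le _).trans_lt h2, (norm_snd_le _).trans_lt h2⟩
  have hBball : ∀ i, ∀ w ∈ B i, w - A i ∈ Metric.ball (0 : ℝ × ℝ × ℝ) (ε (e i)) := fun i w hw =>
    Metric.ball_subset_ball (by linarith [hε (e i)]) hw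
  have huniq : ∀ i j w, w ∈ B i → w ∈ B j → i = j := fun i j w hi hj =>
    hdisj i j _ _ (hB i w hi).1 (hB j w hj).1 (by ring)
  have hcurve : ∀ i, ∀ w ∈ B i, curveMap ((1 - C) / 2) Γ ν Γ' ν' w =
      curveMap ((1 - C) / 2) (γ (e i)) (n (e i)) (γ' (e i)) (n' (e i)) (w - A i) := by
    intro i w hw
    obtain ⟨h1, h2⟩ := hB i w hw
    obtain ⟨-, h3, h4⟩ := hΓγ i _ h1
    obtain ⟨-, h5, h6⟩ := hΓγ' i _ h2
    rw [add_sub_cancel] at h3 h4 h5 h6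
    simp only [curveMap, h3, h4, h5, h6, A, Prod.fst_sub, Prod.snd_sub, sub_zero]
  classical
  let G : ℝ × ℝ × ℝ → M := fun w =>
    if h : ∃ i, w ∈ B i then g (e h.choose) (w - A h.choose) else Classical.arbitrary M
  have hG : ∀ i, ∀ w ∈ B i, G w = g (e i) (w - A i) := by
    intro i w hw
    have h : ∃ i, w ∈ B i := ⟨i, hw⟩
    have hi : h.choose = i := huniq _ _ w h.choose_spec hw
    simp only [G, dif_pos h, hi]
  refine ⟨⋃ i, B i, G, isOpen_iUnion hBo, ?_, ?_, ?_, ?_, ?_⟩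
  · intro w hw
    obtain ⟨i, hi⟩ := mem_iUnion.1 hw
    obtain ⟨h1, h2⟩ := hB i w hi
    have h3 := (hΓγ i _ h1).1
    have h4 := (hΓγ' i _ h2).1
    rw [add_sub_cancel] at h3 h4
    exact ⟨h3, h4⟩
  · intro w hw
    obtain ⟨i, hi⟩ := mem_iUnion.1 hw
    have h1 : curveMap ((1 - C) / 2) Γ ν Γ' ν' =ᶠ[𝓝 w] fun w =>
        curveMap ((1 - C) / 2) (γ (e i)) (n (e i)) (γ' (e i)) (n' (e i)) (w - A i) := by
      filter_upwards [(hBo i).mem_nhds hi] with z hz using hcurve i z hz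
    rw [h1.fderiv_eq, fderiv_comp_sub]
    exact (hmap (e i) _ (hBball i w hi)).2
  · intro w hw
    obtain ⟨i, hi⟩ := mem_iUnion.1 hw
    refine ContMDiffAt.contMDiffWithinAt ?_
    have h1 : G =ᶠ[𝓝 w] fun w => g (e i) (w - A i) := by
      filter_upwards [(hBo i).mem_nhds hi] with z hz using hG i z hz
    refine ContMDiffAt.congr_of_eventuallyEq ?_ h1
    have h2 := (hgs (e i)).contMDiffAt (Metric.isOpen_ball.mem_nhds (hBball i w hi))
    have h3 : ContMDiffAt 𝓘(ℝ, ℝ × ℝ × ℝ) 𝓘(ℝ, ℝ × ℝ × ℝ) ∞ (fun w => w - A i) w :=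
      (contDiffAt_id.sub contDiffAt_const).contMDiffAt
    exact ContMDiffAt.comp w h2 h3
  · rw [eq_univ_iff_forall]
    intro x
    have hx : x ∈ ⋃ y ∈ s, g y '' Metric.ball 0 (ε y / 4) := by rw [hsU]; trivial
    simp only [mem_iUnion] at hx
    obtain ⟨y, hy, w, hw, rfl⟩ := hx
    rw [he] at hy
    obtain ⟨i, rfl⟩ := hy
    have hwB : w + A i ∈ B i := by
      change w + A i - A i ∈ Metric.ball 0 (ε (e i) / 4)
      rwa [add_sub_cancel_right]
    exact ⟨w + A i, mem_iUnion.2 ⟨i, hwB⟩, by rw [hG i _ hwB, add_sub_cancel_right]⟩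
  · intro w hw
    obtain ⟨i, hi⟩ := mem_iUnion.1 hw
    rw [hG i w hi, hcurve i w hi]
    exact (hmap (e i) _ (hBball i w hi)).1

/-- The frame of a curve of `ℍ²` and its derivative (Frenet equations). -/
lemma IsCurveWithNormal.frenet {I : Set ℝ} {γ n : ℝ → R3} {κ : ℝ → ℝ}
    (h : IsCurveWithNormal I γ n κ) {r : ℝ} (hr : r ∈ I) :
    IsFrame (γ r) (n r) ∧ ∃ σ k : ℝ, HasDerivAt γ (σ • lcross (γ r) (n r)) r ∧
      HasDerivAt n (k • lcross (γ r) (n r)) r := by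
  have hn := h.isOpen.mem_nhds hr
  have hγd : HasDerivAt γ (deriv γ r) r :=
    ((h.smooth.contDiffAt hn).differentiableAt (by simp)).hasDerivAt
  have hnd : HasDerivAt n (deriv n r) r :=
    ((h.smooth_normal.contDiffAt hn).differentiableAt (by simp)).hasDerivAt
  have hf : IsFrame (γ r) (n r) :=
    ⟨(h.mem r hr).1, h.normal_unit r hr, by rw [mink_comm]; exact h.normal_tangent r hr⟩
  have h1 : mink (deriv γ r) (γ r) = 0 := by
    rw [mink_comm]
    exact mink_deriv_eq_zero (by filter_upwards [hn] with x hx using (h.mem x hx).1) hγd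
  have h2 : mink (deriv γ r) (n r) = 0 := by rw [mink_comm]; exact h.normal_orthogonal r hr
  have h3 : mink (deriv n r) (n r) = 0 := by
    have h4 := (hnd.mink hnd).unique ((hasDerivAt_const r (1 : ℝ)).congr_of_eventuallyEq
      (by filter_upwards [hn] with x hx using h.normal_unit x hx))
    rw [mink_comm (n r)] at h4
    linarith
  have h4 : mink (deriv n r) (γ r) = 0 := by
    have h5 := (hnd.mink hγd).unique ((hasDerivAt_const r (0 : ℝ)).congr_of_eventuallyEq
      (by filter_upwards [hn] with x hx using h.normal_tangent x hx))
    rw [h.normal_orthogonal r hr] at h5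
    linarith
  have h5 := hf.expand (deriv γ r)
  have h6 := hf.expand (deriv n r)
  rw [h1, h2, neg_zero, zero_smul, zero_smul, zero_add, zero_add] at h5
  rw [h3, h4, neg_zero, zero_smul, zero_smul, zero_add, zero_add] at h6
  exact ⟨hf, _, _, h5 ▸ hγd, h6 ▸ hnd⟩

/-- The unit normal field of the hypersurface built from two curves. -/
noncomputable def curveNormal (c : ℝ) (γ n γ' n' : ℝ → R3) (w : ℝ × ℝ × ℝ) : R6 :=
  (√(1 - c) • (Real.sinh (√c * w.1) • γ w.2.1 + Real.cosh (√c * w.1) • n w.2.1),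
    -√c • (Real.sinh (√(1 - c) * w.1) • γ' w.2.2 + Real.cosh (√(1 - c) * w.1) • n' w.2.2))

/-- For the hypersurface built from two curves, the field `J₁ N + J₂ N` is tangent to the
parallels of the first curve, along which only the first factor of the normal moves. -/
lemma principal_of_curves {f N : M → R6} (hf : IsOrientedHypersurface f N) {c : ℝ} (hc0 : 0 < c)
    (hc1 : c < 1) {I I' : Set ℝ} {γ n γ' n' : ℝ → R3} {κ κ' : ℝ → ℝ}
    (hγ : IsCurveWithNormal I γ n κ) (hγ' : IsCurveWithNormal I' γ' n' κ')
    (hopen : IsOpenPart f I I' (curveMap c γ n γ' n')) :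
    IsPrincipalField f N (fun x => J1 (f x) (N x) + J2 (f x) (N x)) := by
  obtain ⟨Ω, g, hΩ, hΩI, hinj, hg, hsurj, hfg⟩ := hopen
  set a := √(1 - c) with ha_def
  set b := √c with hb_def
  have ha : 0 < a := Real.sqrt_pos.2 (by linarith)
  have hb : 0 < b := Real.sqrt_pos.2 hc0
  have hab : a ^ 2 + b ^ 2 = 1 := by
    rw [ha_def, hb_def, Real.sq_sqrt hc0.le, Real.sq_sqrt (by linarith)]; ring
  set Φ := curveMap c γ n γ' n' with hΦ
  set K := curveNormal c γ n γ' n' with hK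
  have hgd : ∀ w ∈ Ω, MDifferentiableAt 𝓘(ℝ, ℝ × ℝ × ℝ) (𝓡 3) g w := fun w hw =>
    (hg.contMDiffAt (hΩ.mem_nhds hw)).mdifferentiableAt (by simp)
  have hfgΦ : ∀ w ∈ Ω, Φ =ᶠ[𝓝 w] fun w => f (g w) := fun w hw => by
    filter_upwards [hΩ.mem_nhds hw] with z hz using (hfg z hz).symm
  have hΦd : ∀ w ∈ Ω, HasFDerivAt Φ (fderiv ℝ Φ w) w := fun w hw => by
    have h1 : ContDiffAt ℝ ∞ (fun w => f (g w)) w :=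
      ((hf.smooth (g w)).comp w (hg.contMDiffAt (hΩ.mem_nhds hw))).contDiffAt
    exact ((h1.differentiableAt (by simp)).congr_of_eventuallyEq (hfgΦ w hw)).hasFDerivAt
  have hΦX : ∀ w ∈ Ω, ∀ X, fderiv ℝ Φ w X = diff f (g w) (mfderiv 𝓘(ℝ, _) (𝓡 3) g w X) :=
    fun w hw X => by rw [(hfgΦ w hw).fderiv_eq, fderiv_comp_param hf.smooth (hgd w hw)]
  -- the coordinate lines
  have hline₁ : ∀ w : ℝ × ℝ × ℝ, HasDerivAt (fun t => (t, w.2)) ((1, 0) : ℝ × ℝ × ℝ) w.1 :=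
    fun w => (hasDerivAt_id _).prodMk (hasDerivAt_const _ _)
  have hline₂ : ∀ w : ℝ × ℝ × ℝ,
      HasDerivAt (fun r => (w.1, r, w.2.2)) ((0, 1, 0) : ℝ × ℝ × ℝ) w.2.1 :=
    fun w => (hasDerivAt_const _ _).prodMk ((hasDerivAt_id _).prodMk (hasDerivAt_const _ _))
  have hline₃ : ∀ w : ℝ × ℝ × ℝ,
      HasDerivAt (fun s => (w.1, w.2.1, s)) ((0, 0, 1) : ℝ × ℝ × ℝ) w.2.2 :=
    fun w => (hasDerivAt_const _ _).prodMk ((hasDerivAt_const _ _).prodMk (hasDerivAt_id _))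
  have hexp : ∀ (d : ℝ) (x y : R3) (t : ℝ),
      HasDerivAt (fun t => Real.cosh (d * t) • x + Real.sinh (d * t) • y)
        (d • (Real.sinh (d * t) • x + Real.cosh (d * t) • y)) t := by
    intro d x y t
    have h1 : HasDerivAt (fun t => d * t) d t := by simpa using (hasDerivAt_id t).const_mul d
    refine ((h1.cosh.smul_const x).add (h1.sinh.smul_const y)).congr_deriv ?_
    module
  have hlin : ∀ {y z : ℝ → R3} {y' z' : R3} {r : ℝ} (A B : ℝ), HasDerivAt y y' r →
      HasDerivAt z z' r → HasDerivAt (fun r => A • y r + B • z r) (A • y' + B • z') r :=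
    fun A B hy hz => (hy.const_smul A).add (hz.const_smul B)
  -- the normal of `M` is the normal of the parametrized hypersurface, up to sign
  have hnormal : ∀ w ∈ Ω, N (g w) = mink2 (N (g w)) (K w) • K w ∧
      mink2 (N (g w)) (K w) ^ 2 = 1 := by
    intro w hw
    obtain ⟨hF, σ, k, hd, hd'⟩ := hγ.frenet (hΩI w hw).1
    obtain ⟨hF', σ', k', hd₁, hd₁'⟩ := hγ'.frenet (hΩI w hw).2
    set u := Real.sinh (b * w.1) • γ w.2.1 + Real.cosh (b * w.1) • n w.2.1 with hu
    set v := Real.sinh (a * w.1) • γ' w.2.2 + Real.cosh (a * w.1) • n' w.2.2 with hv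
    have hB : IsFrame (Φ w).1 u := hF.boost (b * w.1)
    have hB' : IsFrame (Φ w).2 v := hF'.boost (a * w.1)
    have he : lcross (Φ w).1 u = lcross (γ w.2.1) (n w.2.1) := lcross_boost _ _ _
    have he' : lcross (Φ w).2 v = lcross (γ' w.2.2) (n' w.2.2) := lcross_boost _ _ _
    have h0 : HasDerivAt (fun t => Φ (t, w.2)) (b • u, a • v) w.1 :=
      (hexp b (γ w.2.1) (n w.2.1) w.1).prodMk (hexp a (γ' w.2.2) (n' w.2.2) w.1)
    have h0' := (hΦd w hw).comp_hasDerivAt w.1 (hline₁ w)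
    have h1 : fderiv ℝ Φ w (1, 0) = (b • u, a • v) := h0'.unique h0
    have h2 : fderiv ℝ Φ w (0, 1, 0) = _ :=
      ((hΦd w hw).comp_hasDerivAt w.2.1 (hline₂ w)).unique
        ((hlin (Real.cosh (b * w.1)) (Real.sinh (b * w.1)) hd hd').prodMk
          (hasDerivAt_const _ (Φ w).2))
    have h3 : fderiv ℝ Φ w (0, 0, 1) = _ :=
      ((hΦd w hw).comp_hasDerivAt w.2.2 (hline₃ w)).unique
        ((hasDerivAt_const _ (Φ w).1).prodMk
          (hlin (Real.cosh (a * w.1)) (Real.sinh (a * w.1)) hd₁ hd₁'))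
    rw [smul_smul, smul_smul, ← add_smul, ← he] at h2
    rw [smul_smul, smul_smul, ← add_smul, ← he'] at h3
    -- `Φ` is immersive, so the parallels of both curves are regular
    have hl : Real.cosh (b * w.1) * σ + Real.sinh (b * w.1) * k ≠ 0 := by
      intro h0
      rw [h0, zero_smul] at h2
      have := (injective_iff_map_eq_zero _).1 (hinj w hw) (0, 1, 0) h2
      simp at this
    have hl' : Real.cosh (a * w.1) * σ' + Real.sinh (a * w.1) * k' ≠ 0 := by
      intro h0
      rw [h0, zero_smul] at h3
      have := (injective_iff_map_eq_zero _).1 (hinj w hw) (0, 0, 1) h3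
      simp at this
    have horth : ∀ X, mink2 (fderiv ℝ Φ w X) (N (g w)) = 0 := fun X => by
      rw [hΦX w hw]; exact hf.normal_orthogonal _ _
    have ht := hf.normal_tangent (g w)
    rw [hfg w hw] at ht
    have hn1 := horth (1, 0)
    have hn2 := horth (0, 1, 0)
    have hn3 := horth (0, 0, 1)
    rw [h1] at hn1
    rw [h2] at hn2
    rw [h3] at hn3
    simp only [mink2, mink_smul_left, mink_zero_left, add_zero, zero_add, mul_eq_zero, hl, hl',
      false_or] at hn1 hn2 hn3
    have hN1 := hB.expand (N (g w)).1
    have hN2 := hB'.expand (N (g w)).2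
    rw [ht.1, mink_comm _ (lcross _ _), hn2, neg_zero, zero_smul, zero_smul, zero_add, add_zero]
      at hN1
    rw [ht.2, mink_comm _ (lcross _ _), hn3, neg_zero, zero_smul, zero_smul, zero_add, add_zero]
      at hN2
    have hKw : K w = (a • u, -b • v) := rfl
    have hunit := hf.normal_unit (g w)
    rw [mink_comm u, mink_comm v] at hn1
    rw [mink2, hN1, hN2] at hunit
    simp only [mink2, hKw, mink_smul_left, mink_smul_right, hB.uu, hB'.uu, mul_one] at hunit ⊢
    generalize hα : mink (N (g w)).1 u = α at *
    generalize hβ : mink (N (g w)).2 v = β at *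
    refine ⟨Prod.ext ?_ ?_, ?_⟩
    · change (N (g w)).1 = (a * α + -b * β) • a • u
      rw [hN1, smul_smul]
      congr 1
      linear_combination (-α) * hab + b * hn1
    · change (N (g w)).2 = (a * α + -b * β) • -b • v
      rw [hN2, smul_smul]
      congr 1
      linear_combination (-β) * hab + a * hn1
    · linear_combination (α ^ 2 + β ^ 2) * hab + hunit - (b * α + a * β) * hn1
  have hKc : ∀ w ∈ Ω, ContinuousAt K w := by
    intro w hw
    have h1 := hγ.isOpen.mem_nhds (hΩI w hw).1
    have h2 := hγ'.isOpen.mem_nhds (hΩI w hw).2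
    have c1 : ContinuousAt (fun w : ℝ × ℝ × ℝ => γ w.2.1) w :=
      ContinuousAt.comp' (hγ.smooth.contDiffAt h1).continuousAt (by fun_prop)
    have c2 : ContinuousAt (fun w : ℝ × ℝ × ℝ => n w.2.1) w :=
      ContinuousAt.comp' (hγ.smooth_normal.contDiffAt h1).continuousAt (by fun_prop)
    have c3 : ContinuousAt (fun w : ℝ × ℝ × ℝ => γ' w.2.2) w :=
      ContinuousAt.comp' (hγ'.smooth.contDiffAt h2).continuousAt (by fun_prop)
    have c4 : ContinuousAt (fun w : ℝ × ℝ × ℝ => n' w.2.2) w :=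
      ContinuousAt.comp' (hγ'.smooth_normal.contDiffAt h2).continuousAt (by fun_prop)
    have hC : ∀ d : ℝ, ContinuousAt (fun w : ℝ × ℝ × ℝ => Real.cosh (d * w.1)) w := fun d =>
      (Real.continuous_cosh.comp (by fun_prop)).continuousAt
    have hS : ∀ d : ℝ, ContinuousAt (fun w : ℝ × ℝ × ℝ => Real.sinh (d * w.1)) w := fun d =>
      (Real.continuous_sinh.comp (by fun_prop)).continuousAt
    exact ((((hS b).smul c1).add ((hC b).smul c2)).const_smul a).prodMk
      ((((hS a).smul c3).add ((hC a).smul c4)).const_smul (-b))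
  have hmink2 : Continuous fun z : R6 × R6 => mink2 z.1 z.2 := by
    unfold mink2 mink; fun_prop
  intro x
  obtain ⟨w, hw, rfl⟩ : x ∈ g '' Ω := by rw [hsurj]; trivial
  set τ := mink2 (N (g w)) (K w) with hτ
  have hτ2 : τ ^ 2 = 1 := (hnormal w hw).2
  -- the sign is continuous, hence locally constant
  have hsign : ∀ᶠ z in 𝓝 w, mink2 (N (g z)) (K z) = τ := by
    have hc : ContinuousAt (fun z => mink2 (N (g z)) (K z)) w := by
      have h1 : ContinuousAt (fun z => N (g z)) w :=
        ContinuousAt.comp' (hf.smooth_normal.continuous.continuousAt)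
          (hg.contMDiffAt (hΩ.mem_nhds hw)).continuousAt
      exact hmink2.continuousAt.comp' (h1.prodMk (hKc w hw))
    filter_upwards [hc.eventually_mem (Metric.ball_mem_nhds τ one_pos), hΩ.mem_nhds hw]
      with z hz hz'
    have h1 := (hnormal z hz').2
    rw [Metric.mem_ball, Real.dist_eq, abs_lt] at hz
    rcases sq_eq_sq_iff_eq_or_eq_neg.1 (h1.trans hτ2.symm) with h2 | h2
    · exact h2
    · rcases sq_eq_sq_iff_eq_or_eq_neg.1 (hτ2.trans (one_pow 2).symm) with h3 | h3 <;> rw [h2] at hz <;> linarith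
  have hNK : (fun z => N (g z)) =ᶠ[𝓝 w] fun z => τ • K z := by
    filter_upwards [hsign, hΩ.mem_nhds hw] with z hz hz'
    have := (hnormal z hz').1
    rwa [hz] at this
  have hNgd : HasFDerivAt (fun z => τ • K z) (fderiv ℝ (fun z => N (g z)) w) w := by
    have h1 : ContDiffAt ℝ ∞ (fun w => N (g w)) w :=
      ((hf.smooth_normal (g w)).comp w (hg.contMDiffAt (hΩ.mem_nhds hw))).contDiffAt
    exact (h1.differentiableAt (by simp)).hasFDerivAt.congr_of_eventuallyEq hNK.symm
  obtain ⟨hF, σ, k, hd, hd'⟩ := hγ.frenet (hΩI w hw).1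
  set u := Real.sinh (b * w.1) • γ w.2.1 + Real.cosh (b * w.1) • n w.2.1 with hu
  have hB : IsFrame (Φ w).1 u := hF.boost (b * w.1)
  set e := lcross (γ w.2.1) (n w.2.1) with he_def
  have he : lcross (Φ w).1 u = e := lcross_boost _ _ _
  have hee : mink e e = 1 := hF.ee
  have hep : mink e (Φ w).1 = 0 := by rw [← he]; simp
  have h2 : fderiv ℝ Φ w (0, 1, 0) = _ :=
    ((hΦd w hw).comp_hasDerivAt w.2.1 (hline₂ w)).unique
      ((hlin (Real.cosh (b * w.1)) (Real.sinh (b * w.1)) hd hd').prodMk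
        (hasDerivAt_const _ (Φ w).2))
  have h3 : fderiv ℝ (fun z => N (g z)) w (0, 1, 0) = _ :=
    (hNgd.comp_hasDerivAt w.2.1 (hline₂ w)).unique
      ((((hlin (Real.sinh (b * w.1)) (Real.cosh (b * w.1)) hd hd').const_smul a).prodMk
        (hasDerivAt_const _ (K w).2)).const_smul τ)
  rw [smul_smul, smul_smul, ← add_smul] at h2 h3
  set m := Real.cosh (b * w.1) * σ + Real.sinh (b * w.1) * k with hm_def
  set m' := Real.sinh (b * w.1) * σ + Real.cosh (b * w.1) * k with hm'_def
  have hm : m ≠ 0 := by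
    intro h0
    rw [h0, zero_smul] at h2
    have := (injective_iff_map_eq_zero _).1 (hinj w hw) (0, 1, 0) h2
    simp at this
  have hτ0 : τ ≠ 0 := by rintro h0; rw [h0] at hτ2; norm_num at hτ2
  set μ := 2 * τ * a / m with hμ
  have hW : J1 (f (g w)) (N (g w)) + J2 (f (g w)) (N (g w)) = ((2 * τ * a) • e, 0) := by
    rw [hfg w hw, (hnormal w hw).1]
    refine Prod.ext ?_ (add_neg_cancel _)
    change lcross (Φ w).1 (τ • a • u) + lcross (Φ w).1 (τ • a • u) = _
    rw [lcross_smul_right, lcross_smul_right, he]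
    module
  have hX : diff f (g w) (mfderiv 𝓘(ℝ, _) (𝓡 3) g w (μ • ((0, 1, 0) : ℝ × ℝ × ℝ))) =
      ((2 * τ * a) • e, 0) := by
    rw [← hΦX w hw, map_smul, h2, Prod.smul_mk, smul_smul, smul_zero, hμ, div_mul_cancel₀ _ hm]
  refine ⟨mfderiv 𝓘(ℝ, _) (𝓡 3) g w (μ • ((0, 1, 0) : ℝ × ℝ × ℝ)), ?_, hX.trans hW.symm,
    -(τ * a * m' / m), ?_⟩
  · intro h0
    rw [h0, map_zero] at hX
    have h4 := congrArg (fun z : R6 => mink z.1 e) hX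
    simp [hee, hτ0, ha.ne'] at h4
  · rw [covDerivNormal, ← fderiv_comp_param hf.smooth_normal (hgd w hw), map_smul, map_smul, hX, h3,
      hfg w hw]
    refine Prod.ext ?_ ?_
    · simp only [tangentProj, Prod.smul_fst, mink_smul_left, hep, mul_zero, zero_smul,
        add_zero, smul_smul, ← neg_smul]
      congr 1
      rw [hμ]
      field_simp
    · simp [tangentProj]

end Manifold

end HypProd

theorem proposition3p9 {M : Type*} [Nonempty M] [TopologicalSpace M] [T2Space M]
    [SecondCountableTopology M]
    [ChartedSpace (EuclideanSpace ℝ (Fin 3)) M] [IsManifold (𝓡 3) ∞ M]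
    (f N : M → HypProd.R6) (hf : HypProd.IsOrientedHypersurface f N)
    (C : ℝ) (hC : |C| < 1) (hconst : ∀ x, HypProd.productAngle N x = C) :
    HypProd.IsPrincipalField f N (fun x => HypProd.J1 (f x) (N x) + HypProd.J2 (f x) (N x)) ↔
      ∃ (I I' : Set ℝ) (γ n γ' n' : ℝ → HypProd.R3) (κ κ' : ℝ → ℝ),
        HypProd.IsCurveWithNormal I γ n κ ∧ HypProd.IsCurveWithNormal I' γ' n' κ' ∧
        HypProd.IsOpenPart f I I' (HypProd.curveMap ((1 - C) / 2) γ n γ' n') := by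
  refine ⟨HypProd.exists_curves_of_principal hf hC hconst, ?_⟩
  rintro ⟨I, I', γ, n, γ', n', κ, κ', hγ, hγ', hopen⟩
  rw [abs_lt] at hC
  exact HypProd.principal_of_curves hf (by linarith) (by linarith) hγ hγ' hopen
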